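/- Fix integers $0\le m<L$. For each $J\ge 1$ consider an experiment with $T=JL$ periods, split into $J$ consecutive sessions of length $L$; $\mathcal U_j$ denotes the set of the last $n=L-m$ periods of session $j$. Session labels $Z_1,\dots,Z_J$ are independent, $Z_j\sim\mathrm{Bernoulli}(p_j)$ with known $p_j\in(0,1)$, and $W_t=Z_j$ for every period $t$ of session $j$. The potential outcomes $Y_t(\mathbf w)\in\mathbb R$, $t\le T$, $\mathbf w\in\{0,1\}^T$, are fixed, and $Y_t^{\mathrm{obs}}=Y_t(\mathbf W)$. They are non-anticipating ($Y_t(\mathbf w)$ does not depend on $w_s$ for $s>t$) and have $m$-carryover (for $t\ge m+1$, $Y_t(\mathbf w)$ does not depend on $w_s$ for $s<t-m$). The $p_j$ and $Y_t$ may depend on $J$. For $z\in\{0,1\}$ put $\bar Y_j(z)=\frac1n\sum_{t\in\mathcal U_j}Y_t(z,\dots,z)$, let $\tau_\ell=\frac1J\sum_{j=1}^J\{Y_{t_{j,\ell}}(1,\dots,1)-Y_{t_{j,\ell}}(0,\dots,0)\}$, where $t_{j,\ell}$ is the $\ell$-th element of $\mathcal U_j$ ($1\le\ell\le n$), and let $\tau_{\mathcal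 U}=\frac1J\sum_{j=1}^J\{\bar Y_j(1)-\bar Y_j(0)\}$. With $\bar Y_j^{\mathrm{obs}}=\frac1n\sum_{t\in\mathcal U_j}Y_t^{\mathrm{obs}}$ define $T_{\mathrm{stud}}=\hat\tau_{\mathrm{HT}}/\sqrt{\widehat V_{\mathrm{up}}}$ (and $T_{\mathrm{stud}}=0$ if $\widehat V_{\mathrm{up}}=0$), where $$\hat\tau_{\mathrm{HT}}=\frac1J\sum_{j=1}^J\Big(\frac{Z_j\bar Y_j^{\mathrm{obs}}}{p_j}-\frac{(1-Z_j)\bar Y_j^{\mathrm{obs}}}{1-p_j}\Big),\qquad \widehat V_{\mathrm{up}}=\frac1{J^2}\sum_{j=1}^J(\bar Y_j^{\mathrm{obs}})^2\Big(\frac{Z_j}{p_j^2}+\frac{1-Z_j}{(1-p_j)^2}\Big).$$ Let $T^{*}_1,\dots,T^{*}_M$ be obtained by replacing $(Z_1,\dots,Z_J)$ in these formulas by independent copies that are independent of the data, with the $\bar Y_j^{\mathrm{obs}}$ held fixed, and let $\hat p_{\mathrm w}=\frac{1+\#\{b\le M:\,T^{*}_b\ge T_{\mathrm{stud}}\}}{M+1}$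 be the one-sided Monte Carlo $p$-value. The number $M$ of resamples may depend on $J$ in an arbitrary way. Assume that there is $\underline p\in(0,1/2)$ with $\underline p\le p_j\le 1-\underline p$ for all $j$ and $J$, and that (i) there is $C<\infty$ with $\frac1J\sum_{j=1}^J\max\{|\bar Y_j(1)|,|\bar Y_j(0)|\}^4\le C$ for all $J\ge1$; (ii) the empirical measures $\frac1J\sum_{j=1}^J\delta_{(p_j,\bar Y_j(1),\bar Y_j(0))}$ converge weakly, as $J\to\infty$, to a probability measure $\nu$ on $[\underline p,1-\underline p]\times\mathbb R^2$; (iii) for $(P,Y_1,Y_0)\sim\nu$, $\ \sigma_{\mathrm S}^2=\mathbb E_\nu\Big[\Big(\sqrt{\tfrac{1-P}{P}}\,Y_1+\sqrt{\tfrac{P}{1-P}}\,Y_0\Big)^2\Big]>0$. Then, under the focal-average weak null $\tau_{\mathcal U}=0$ (for every $J$), for every $\alpha\in(0,1/2]$, $$\limsup_{J\to\infty}\ \mathbb P(\hat p_{\mathrm w}\le\alpha)\le\alpha .$$ In particular, the same holds under the stronger session-wise weak null $\tau_\ell=0$ for all $\ell=1,\dots,n$ (and every $J$). -/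

import Mathlib

open MeasureTheory ProbabilityTheory Filter Topology
open scoped ENNReal NNReal

namespace Switchback

noncomputable section

/-! Periods are numbered `0, …, T - 1` and treatment is `true`, control is `false`. -/

/-- An assignment path `w ∈ {0,1}^T`. -/
abbrev Path (T : ℕ) : Type := Fin T → Bool

/-- A (fixed, non-random) family of potential outcomes `Y_t(w)`. -/
abbrev PotentialOutcomes (T : ℕ) : Type := Fin T → Path T → ℝ

/-- Non-anticipation: `Y_t` does not depend on the assignments after period `t`. -/
def NonAnticipating {T : ℕ} (Y : PotentialOutcomes T) : Prop :=
  ∀ (t : Fin T) (w w' : Path T), (∀ s, s ≤ t → w s = w' s) → Y t w = Y t w'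

/-- `m`-carryover: for every period `t` that has at least `m` predecessors, `Y_t` does not depend
on the assignments more than `m` periods before `t`. -/
def CarryoverAtMost {T : ℕ} (m : ℕ) (Y : PotentialOutcomes T) : Prop :=
  ∀ (t : Fin T) (w w' : Path T), m ≤ (t : ℕ) →
    (∀ s : Fin T, (t : ℕ) ≤ s + m → w s = w' s) → Y t w = Y t w'

/-- The design of a regular switchback experiment on `T` periods with `N` blocks: the deterministic
switch times, the `k`-th block being `{t : switch k ≤ t < switch (k + 1)}`, and the treatment
probability of each block. -/
structure RegularSwitchback (T N : ℕ) where
  switch : Fin (N + 1) → ℕ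
  switch_zero : switch 0 = 0
  switch_last : switch (Fin.last N) = T
  switch_strictMono : StrictMono switch
  q : Fin N → ℝ
  q_mem : ∀ k, q k ∈ Set.Ioo (0 : ℝ) 1

namespace RegularSwitchback

variable {T N : ℕ}

/-- Period `t` belongs to block `k`. -/
def InBlock (D : RegularSwitchback T N) (k : Fin N) (t : Fin T) : Prop :=
  D.switch k.castSucc ≤ t ∧ (t : ℕ) < D.switch k.succ

open Classical in
/-- The assignment path whose value on the `k`-th block is the block label `z k`. -/
def path (D : RegularSwitchback T N) (z : Fin N → Bool) : Path T :=
  fun t => decide (∃ k, D.InBlock k t ∧ z k = true)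

theorem path_eq (D : RegularSwitchback T N) (z : Fin N → Bool) {k : Fin N} {t : Fin T}
    (h : D.InBlock k t) : D.path z t = z k := by
  have huniq : ∀ l, D.InBlock l t → l = k := by
    intro l hl
    rcases lt_trichotomy l k with hlt | heq | hgt
    · have h1 : D.switch l.succ ≤ D.switch k.castSucc :=
        D.switch_strictMono.monotone (Fin.le_def.2 (by simpa using hlt))
      exact absurd (hl.2.trans_le h1) (not_lt.2 h.1)
    · exact heq
    · have h1 : D.switch k.succ ≤ D.switch l.castSucc :=
        D.switch_strictMono.monotone (Fin.le_def.2 (by simpa using hgt))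
      exact absurd (h.2.trans_le h1) (not_lt.2 hl.1)
  cases hz : z k
  · simp only [path, decide_eq_false_iff_not]
    rintro ⟨l, hl, hzl⟩
    rw [huniq l hl, hz] at hzl
    exact Bool.false_ne_true hzl
  · simp only [path, decide_eq_true_eq]
    exact ⟨k, h, hz⟩

/-- The law of the block labels: independent, the `k`-th one being Bernoulli with parameter
`q k`. -/
def labelLaw (D : RegularSwitchback T N) : Measure (Fin N → Bool) :=
  Measure.pi fun k =>
    bernoulliMeasure true false ⟨D.q k, (D.q_mem k).1.le, (D.q_mem k).2.le⟩

/-- All blocks have length `L`. -/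
def EqualLength (D : RegularSwitchback T N) (L : ℕ) : Prop :=
  ∀ k : Fin N, D.switch k.succ = D.switch k.castSucc + L

end RegularSwitchback

/-! `J` sessions of length `L`, with the first `m` periods of each session discarded. -/

/-- The `ℓ`-th focal period of session `j`. -/
def focalTime (L m : ℕ) {J : ℕ} (j : Fin J) (l : Fin (L - m)) : Fin (J * L) :=
  ⟨j * L + m + l, by
    have h1 : m + (l : ℕ) < L := by have := l.isLt; omega
    have h2 : ((j : ℕ) + 1) * L ≤ J * L := Nat.mul_le_mul_right L j.isLt
    have h3 : ((j : ℕ) + 1) * L = j * L + L := by ring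
    omega⟩

/-- The focal potential outcome `Y_{j,ℓ}(z)` under the constant path `z`. -/
def focalOutcome (L m : ℕ) {J : ℕ} (Y : PotentialOutcomes (J * L)) (j : Fin J) (l : Fin (L - m))
    (z : Bool) : ℝ :=
  Y (focalTime L m j l) (fun _ => z)

/-- The session-level focal mean potential outcome `Ȳ_j(z)`. -/
def focalMean (L m : ℕ) {J : ℕ} (Y : PotentialOutcomes (J * L)) (j : Fin J) (z : Bool) : ℝ :=
  (∑ l, focalOutcome L m Y j l z) / ((L - m : ℕ) : ℝ)

/-- The cross-session average effect `τ_ℓ` at focal position `ℓ`. -/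
def positionEffect (L m : ℕ) {J : ℕ} (Y : PotentialOutcomes (J * L)) (l : Fin (L - m)) : ℝ :=
  (∑ j, (focalOutcome L m Y j l true - focalOutcome L m Y j l false)) / (J : ℝ)

/-- The focal-average effect `τ_U`. -/
def focalAverageEffect (L m : ℕ) {J : ℕ} (Y : PotentialOutcomes (J * L)) : ℝ :=
  (∑ j, (focalMean L m Y j true - focalMean L m Y j false)) / (J : ℝ)

/-- The observed session-level focal mean, computed from the outcomes realized under the path
`w`. -/
def observedMean (L m : ℕ) {J : ℕ} (Y : PotentialOutcomes (J * L)) (w : Path (J * L))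
    (j : Fin J) : ℝ :=
  (∑ l, Y (focalTime L m j l) w) / ((L - m : ℕ) : ℝ)

/-! The test. Below, `p` are the session probabilities, `y` the observed session means and `z` the
session labels, real or resampled. -/

/-- The Horvitz–Thompson estimator. -/
def tauHT {J : ℕ} (p y : Fin J → ℝ) (z : Fin J → Bool) : ℝ :=
  (∑ j, if z j = true then y j / p j else -(y j / (1 - p j))) / (J : ℝ)

/-- The upper-bound variance estimator. -/
def varUp {J : ℕ} (p y : Fin J → ℝ) (z : Fin J → Bool) : ℝ :=
  (∑ j, y j ^ 2 * (if z j = true then 1 / p j ^ 2 else 1 / (1 - p j) ^ 2)) / (J : ℝ) ^ 2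

/-- The studentized statistic (equal to `0` if the variance estimator vanishes). -/
def tStud {J : ℕ} (p y : Fin J → ℝ) (z : Fin J → Bool) : ℝ :=
  tauHT p y z / √(varUp p y z)

/-- The one-sided Monte Carlo `p`-value `(1 + #{b : T*_b ≥ T_obs}) / (M + 1)` for the observed
labels `z` and the resampled labels `zs 0, …, zs (M - 1)`; the observed means `y` are held fixed. -/
def monteCarloPValue {J M : ℕ} (p y : Fin J → ℝ) (z : Fin J → Bool)
    (zs : Fin M → Fin J → Bool) : ℝ :=
  (((Finset.univ.filter fun b => tStud p y z ≤ tStud p y (zs b)).card : ℝ) + 1) / ((M : ℝ) + 1)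

/-- The `p`-value of the studentized test in the experiment with design `D` and potential
outcomes `Y`: the realized path is `D.path z`. -/
def crtPValue (L m : ℕ) {J M : ℕ} (D : RegularSwitchback (J * L) J) (Y : PotentialOutcomes (J * L))
    (z : Fin J → Bool) (zs : Fin M → Fin J → Bool) : ℝ :=
  monteCarloPValue D.q (observedMean L m Y (D.path z)) z zs

/-- The joint law of the realized labels and of `M` resampled label vectors: all of them are
independent and follow the label law of the design. -/
def jointLaw {T N : ℕ} (D : RegularSwitchback T N) (M : ℕ) :
    Measure ((Fin N → Bool) × (Fin M → Fin N → Bool)) :=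
  D.labelLaw.prod (Measure.pi fun _ => D.labelLaw)

/-- The probability that the test with `M` resamples rejects at level `α`. -/
def rejectionProb (L m : ℕ) {J : ℕ} (D : RegularSwitchback (J * L) J)
    (Y : PotentialOutcomes (J * L)) (M : ℕ) (α : ℝ) : ℝ≥0∞ :=
  jointLaw D M {x | crtPValue L m D Y x.1 x.2 ≤ α}

/-- The empirical measure of `(p_j, Ȳ_j(1), Ȳ_j(0))`, `j = 1, …, J` (for `J = 0` it is zero). -/
def empiricalLaw (L m : ℕ) {J : ℕ} (D : RegularSwitchback (J * L) J)
    (Y : PotentialOutcomes (J * L)) : FiniteMeasure (ℝ × ℝ × ℝ) :=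
  (J : ℝ≥0)⁻¹ • ∑ j, (diracProba (D.q j, focalMean L m Y j true, focalMean L m Y j false)).toFiniteMeasure

/-- The asymptotic sampling variance `σ_S²` under the limit law `ν` of `(P, Y₁, Y₀)`. -/
def sigmaSqS (ν : ProbabilityMeasure (ℝ × ℝ × ℝ)) : ℝ :=
  ∫ x, (√((1 - x.1) / x.1) * x.2.1 + √(x.1 / (1 - x.1)) * x.2.2) ^ 2 ∂(ν : Measure (ℝ × ℝ × ℝ))

end

end Switchback

/-!
Let `X_j` be `Ȳ_j(1) / p_j` for a treated session and `-Ȳ_j(0) / (1 - p_j)` for a control session.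
Discarding the first `m` periods of each session removes all carryover between sessions, so the
observed mean of session `j` is `Ȳ_j(Z_j)` (`observedMean_path`) and the studentized statistic is
the self-normalized sum `∑ X_j / √(∑ X_j ^ 2)` of independent variables. The resampled statistics
have the same form, with the observed mean in the role of both potential outcomes.

*Limit laws.* A Lyapunov-type central limit theorem, proved with characteristic functions, and
Chebyshev's inequality for `∑ X_j ^ 2` show that such a self-normalized sum, whose summands have
total mean zero, is asymptotically `N(0, r)` with `r = lim ∑ Var X_j / ∑ E X_j ^ 2`
(`eventually_selfNormalized_tail_le`). For the observed statistic the weak null makes the total mean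
vanish, and `0 < r ≤ 1` (`exists_observed_tail_le`); the two averages converge because the empirical
measures do and fourth moments are bounded (`tendsto_average`). For the resampled statistics every
summand is centred, so `r = 1`, uniformly over nondegenerate data
(`eventually_forall_resampled_tail_le`).

*The exact resampling `p`-value.* Consequently the conditional probability `U` that a resampled
statistic is at least the observed one is asymptotically distributed as `1 - Φ(X)`, `X ~ N(0, r)`.
Its distribution function `F` is continuous, satisfies `F v ≤ v` for `v ≤ 1 / 2` since `r ≤ 1`, and
is symmetric about `1 / 2`. As `F` is continuous, the asymptotic bound on the distribution function
of `U` by `F` is uniform (`eventually_forall_le_of_monotone`).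

*Arbitrary numbers of resamples.* Given the data, the number of the `M` resamples that are at least
as extreme is binomial, so the test rejects with probability `E g(U)`, where `g` is a binomial tail
with `k = ⌊α (M + 1)⌋` (`rejectionProb_eq`). As `-g'` is a beta density `b`, this equals the integral
of `b(v) P(U < v)`, hence is at most `∫ b F` up to a uniform error that does not depend on `M`. For
`k ≤ (M + 1) / 2` the density satisfies `b(1 - v) ≤ b(v)` for `v ≤ 1 / 2`; pairing `v` with `1 - v`
then shows `∫ b F ≤ ∫ b(v) v dv = k / (M + 1) ≤ α` (`integral_betaDensity_mul_le`).
-/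

namespace Switchback

/-! ### Characteristic functions of sums of independent finitely-valued variables -/

/-- The characteristic function, at `u`, of a sum of independent variables with zero total mean. -/
theorem integral_cexp_sum_pi {Ω : Type*} [MeasurableSpace Ω] {n : ℕ}
    (μ : Fin n → Measure Ω) [∀ k, IsProbabilityMeasure (μ k)]
    (X : Fin n → Ω → ℝ) (h0 : ∑ k, ∫ ω, X k ω ∂(μ k) = 0) (u : ℝ) :
    ∫ ω, Complex.exp ((u * ∑ k, X k (ω k) : ℝ) * Complex.I) ∂(Measure.pi μ)
      = ∏ k, ∫ ω, Complex.exp ((u * (X k ω - ∫ x, X k x ∂(μ k)) : ℝ) * Complex.I) ∂(μ k) := by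
  rw [← integral_fintype_prod_eq_prod]
  congr 1; ext ω
  rw [← Complex.exp_sum, ← Finset.sum_mul, ← Complex.ofReal_sum, ← Finset.mul_sum,
    Finset.sum_sub_distrib, h0, sub_zero]

section Moments

variable {Ω : Type*} [Fintype Ω] [MeasurableSpace Ω] [MeasurableSingletonClass Ω]

theorem memLp_of_fintype (μ : Measure Ω) [IsFiniteMeasure μ] (f : Ω → ℝ) (p : ℝ≥0∞) :
    MemLp f p μ := MemLp.of_discrete

theorem sq_integral_le (μ : Measure Ω) [IsProbabilityMeasure μ] (f : Ω → ℝ) :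
    (∫ ω, f ω ∂μ) ^ 2 ≤ ∫ ω, f ω ^ 2 ∂μ := by
  have h := variance_nonneg f μ
  rw [variance_eq_sub (memLp_of_fintype μ f 2)] at h
  simpa using h

theorem integral_pow_four_sub_le (μ : Measure Ω) [IsProbabilityMeasure μ] (f : Ω → ℝ) :
    ∫ ω, (f ω - ∫ x, f x ∂μ) ^ 4 ∂μ ≤ 16 * ∫ ω, f ω ^ 4 ∂μ := by
  set m := ∫ x, f x ∂μ
  have hm : m ^ 4 ≤ ∫ ω, f ω ^ 4 ∂μ := by
    have h1 := sq_integral_le μ f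
    have h2 := sq_integral_le μ (fun ω => f ω ^ 2)
    have h3 : (m ^ 2) ^ 2 ≤ (∫ ω, f ω ^ 2 ∂μ) ^ 2 := pow_le_pow_left₀ (sq_nonneg _) h1 2
    calc m ^ 4 = (m ^ 2) ^ 2 := by ring
      _ ≤ _ := h3
      _ ≤ _ := h2
      _ = _ := by simp only [← pow_mul]
  -- Convexity gives `(x - m) ^ 4 ≤ 8 * (x ^ 4 + m ^ 4)`, and `m ^ 4` is at most the fourth moment.
  calc ∫ ω, (f ω - m) ^ 4 ∂μ ≤ ∫ ω, (8 * f ω ^ 4 + 8 * m ^ 4) ∂μ := by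
        refine integral_mono Integrable.of_finite Integrable.of_finite fun ω => ?_
        show (f ω - m) ^ 4 ≤ 8 * f ω ^ 4 + 8 * m ^ 4
        have h1 : (f ω - m) ^ 2 ≤ 2 * (f ω ^ 2 + m ^ 2) := by nlinarith [sq_nonneg (f ω + m)]
        have h2 : ((f ω - m) ^ 2) ^ 2 ≤ (2 * (f ω ^ 2 + m ^ 2)) ^ 2 :=
          pow_le_pow_left₀ (sq_nonneg _) h1 2
        nlinarith [sq_nonneg (f ω ^ 2 - m ^ 2)]
    _ = 8 * ∫ ω, f ω ^ 4 ∂μ + 8 * m ^ 4 := by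
        rw [integral_add Integrable.of_finite Integrable.of_finite, integral_const_mul]
        simp
    _ ≤ _ := by linarith

theorem variance_sq_le (μ : Measure Ω) [IsProbabilityMeasure μ] (f : Ω → ℝ) :
    Var[f; μ] ^ 2 ≤ ∫ ω, f ω ^ 4 ∂μ := by
  have h0 := variance_nonneg f μ
  have h1 : Var[f; μ] ≤ ∫ ω, f ω ^ 2 ∂μ := by
    rw [variance_eq_sub (memLp_of_fintype μ f 2)]
    simpa using sq_nonneg _
  calc Var[f; μ] ^ 2 ≤ (∫ ω, f ω ^ 2 ∂μ) ^ 2 := pow_le_pow_left₀ h0 h1 2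
    _ ≤ ∫ ω, (f ω ^ 2) ^ 2 ∂μ := sq_integral_le μ _
    _ = _ := by simp only [← pow_mul]

/-- Third-order Taylor bound for the complex exponential on the imaginary axis. -/
theorem norm_cexp_taylor_le (x : ℝ) :
    ‖Complex.exp (x * Complex.I) - (1 + x * Complex.I - (x : ℂ) ^ 2 / 2)‖ ≤ 5 * |x| ^ 3 := by
  rcases le_or_gt |x| 1 with hx | hx
  · have hn : ‖(x : ℂ) * Complex.I‖ = |x| := by simp
    have h := Complex.exp_bound (x := x * Complex.I) (by rw [hn]; exact hx) (n := 3) (by norm_num)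
    rw [hn] at h
    have e : ∑ m ∈ Finset.range 3, ((x : ℂ) * Complex.I) ^ m / (m.factorial : ℂ)
        = 1 + x * Complex.I - (x : ℂ) ^ 2 / 2 := by
      simp [Finset.sum_range_succ, Nat.factorial, mul_pow]
      ring
    rw [e] at h
    refine h.trans ?_
    rw [mul_comm]
    gcongr
    norm_num [Nat.factorial]
  · have h1 : ‖Complex.exp (x * Complex.I) - (1 + x * Complex.I - (x : ℂ) ^ 2 / 2)‖
        ≤ 1 + (1 + |x| + |x| ^ 2 / 2) := by
      refine (norm_sub_le _ _).trans ?_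
      rw [Complex.norm_exp_ofReal_mul_I]
      gcongr
      refine (norm_sub_le _ _).trans ?_
      gcongr
      · refine (norm_add_le _ _).trans ?_
        simp
      · simp
    refine h1.trans ?_
    have h2 : |x| ≤ |x| ^ 3 := by nlinarith [mul_self_nonneg (|x| - 1)]
    have h3 : |x| ^ 2 ≤ |x| ^ 3 := by nlinarith [sq_nonneg |x|]
    nlinarith

theorem abs_exp_neg_sub_le {a : ℝ} (ha : 0 ≤ a) : |Real.exp (-a) - (1 - a)| ≤ a ^ 2 := by
  have h1 : 1 - a ≤ Real.exp (-a) := by linarith [Real.add_one_le_exp (-a)]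
  rw [abs_of_nonneg (by linarith)]
  have h2 : Real.exp (-a) * (1 + a) ≤ 1 := by
    have := Real.add_one_le_exp a
    calc Real.exp (-a) * (1 + a) ≤ Real.exp (-a) * Real.exp a := by
          gcongr; linarith
      _ = 1 := by rw [← Real.exp_add]; simp
  nlinarith [Real.exp_pos (-a), mul_nonneg ha ha, mul_nonneg ha (mul_nonneg ha ha)]

/-- The characteristic function of a centred summand is close to that of a centred Gaussian
variable with the same variance. -/
theorem norm_charFun_sub_gaussian_le (μ : Measure Ω) [IsProbabilityMeasure μ] (f : Ω → ℝ)
    (u : ℝ) :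
    ‖(∫ ω, Complex.exp ((u * (f ω - ∫ x, f x ∂μ) : ℝ) * Complex.I) ∂μ)
        - (Real.exp (-(u ^ 2 * Var[f; μ] / 2)) : ℂ)‖
      ≤ 5 * |u| ^ 3 * (1 + 16 * ∫ ω, f ω ^ 4 ∂μ) + u ^ 4 * ∫ ω, f ω ^ 4 ∂μ := by
  set m := ∫ x, f x ∂μ with hm
  have hv : Var[f; μ] = ∫ ω, (f ω - m) ^ 2 ∂μ :=
    variance_eq_integral (Measurable.of_discrete.aemeasurable)
  have hint : ∫ ω, (1 + ((u * (f ω - m) : ℝ) : ℂ) * Complex.I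
      - ((u * (f ω - m) : ℝ) : ℂ) ^ 2 / 2) ∂μ = ((1 - u ^ 2 * Var[f; μ] / 2 : ℝ) : ℂ) := by
    rw [integral_sub Integrable.of_finite Integrable.of_finite,
      integral_add Integrable.of_finite Integrable.of_finite, integral_mul_const]
    have h1 : ∫ ω, ((u * (f ω - m) : ℝ) : ℂ) ∂μ = 0 := by
      rw [integral_complex_ofReal, integral_const_mul, integral_sub Integrable.of_finite
        Integrable.of_finite]
      simp [hm]
    have h2 : ∫ ω, ((u * (f ω - m) : ℝ) : ℂ) ^ 2 / 2 ∂μ = ((u ^ 2 * Var[f; μ] / 2 : ℝ) : ℂ) := by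
      rw [hv, ← integral_const_mul, ← integral_div, ← integral_complex_ofReal]
      congr 1; ext ω; push_cast; ring
    rw [h1, h2]
    simp
  -- Both exponentials are compared with the common quadratic term `1 - u ^ 2 * Var f / 2`.
  have hA : ‖(∫ ω, Complex.exp ((u * (f ω - m) : ℝ) * Complex.I) ∂μ)
      - ((1 - u ^ 2 * Var[f; μ] / 2 : ℝ) : ℂ)‖ ≤ 5 * |u| ^ 3 * (1 + 16 * ∫ ω, f ω ^ 4 ∂μ) := by
    rw [← hint, ← integral_sub Integrable.of_finite Integrable.of_finite]
    refine (norm_integral_le_integral_norm _).trans ?_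
    calc _ ≤ ∫ ω, 5 * |u| ^ 3 * (1 + (f ω - m) ^ 4) ∂μ := by
          refine integral_mono Integrable.of_finite Integrable.of_finite fun ω => ?_
          refine (norm_cexp_taylor_le _).trans ?_
          rw [abs_mul, mul_pow, ← mul_assoc]
          gcongr
          have e : (f ω - m) ^ 4 = |f ω - m| ^ 4 := by
            rw [← abs_pow, abs_of_nonneg (by positivity)]
          rw [e]
          have := abs_nonneg (f ω - m)
          rcases le_total |f ω - m| 1 with h | h
          · have : |f ω - m| ^ 3 ≤ 1 := pow_le_one₀ this h
            have : 0 ≤ |f ω - m| ^ 4 := by positivity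
            linarith
          · have : |f ω - m| ^ 3 ≤ |f ω - m| ^ 4 := pow_le_pow_right₀ h (by norm_num)
            linarith
      _ = 5 * |u| ^ 3 * (1 + ∫ ω, (f ω - m) ^ 4 ∂μ) := by
          rw [integral_const_mul, integral_add Integrable.of_finite Integrable.of_finite]
          simp
      _ ≤ _ := by
          gcongr
          exact integral_pow_four_sub_le μ f
  have hB : ‖((1 - u ^ 2 * Var[f; μ] / 2 : ℝ) : ℂ) - (Real.exp (-(u ^ 2 * Var[f; μ] / 2)) : ℂ)‖
      ≤ u ^ 4 * ∫ ω, f ω ^ 4 ∂μ := by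
    rw [← Complex.ofReal_sub, Complex.norm_real, Real.norm_eq_abs, abs_sub_comm]
    have h0 := variance_nonneg f μ
    refine (abs_exp_neg_sub_le (by positivity)).trans ?_
    have := variance_sq_le μ f
    calc (u ^ 2 * Var[f; μ] / 2) ^ 2 = u ^ 4 * (Var[f; μ] ^ 2 / 4) := by ring
      _ ≤ _ := by
        gcongr
        have := sq_nonneg Var[f; μ]
        linarith
  calc _ ≤ _ := norm_sub_le_norm_sub_add_norm_sub _ ((1 - u ^ 2 * Var[f; μ] / 2 : ℝ) : ℂ) _
    _ ≤ _ := add_le_add hA hB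

theorem norm_prod_sub_prod_le {ι : Type*} (s : Finset ι) (a b : ι → ℂ)
    (ha : ∀ i, ‖a i‖ ≤ 1) (hb : ∀ i, ‖b i‖ ≤ 1) :
    ‖∏ i ∈ s, a i - ∏ i ∈ s, b i‖ ≤ ∑ i ∈ s, ‖a i - b i‖ := by
  classical
  induction s using Finset.induction_on with
  | empty => simp
  | insert i s hi ih =>
    rw [Finset.prod_insert hi, Finset.prod_insert hi, Finset.sum_insert hi]
    have e : a i * ∏ j ∈ s, a j - b i * ∏ j ∈ s, b j
        = (a i - b i) * ∏ j ∈ s, a j + b i * (∏ j ∈ s, a j - ∏ j ∈ s, b j) := by ring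
    rw [e]
    refine (norm_add_le _ _).trans (add_le_add ?_ ?_)
    · rw [norm_mul]
      refine mul_le_of_le_one_right (norm_nonneg _) ((Finset.norm_prod_le _ _).trans ?_)
      exact Finset.prod_le_one (fun _ _ => norm_nonneg _) fun j _ => ha j
    · rw [norm_mul]
      exact (mul_le_of_le_one_left (norm_nonneg _) (hb i)).trans ih

theorem norm_integral_cexp_sum_sub_le {n : ℕ} (μ : Fin n → Measure Ω)
    [∀ k, IsProbabilityMeasure (μ k)]
    (X : Fin n → Ω → ℝ) (h0 : ∑ k, ∫ ω, X k ω ∂(μ k) = 0) (C : ℝ)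
    (h4 : ∑ k, ∫ ω, X k ω ^ 4 ∂(μ k) ≤ C * n) (u : ℝ) :
    ‖∫ ω, Complex.exp ((u * ∑ k, X k (ω k) : ℝ) * Complex.I) ∂(Measure.pi μ)
        - (Real.exp (-(u ^ 2 * (∑ k, Var[X k; μ k]) / 2)) : ℂ)‖
      ≤ 5 * |u| ^ 3 * (n * (1 + 16 * C)) + u ^ 4 * (C * n) := by
  rw [integral_cexp_sum_pi μ X h0]
  have e : (Real.exp (-(u ^ 2 * (∑ k, Var[X k; μ k]) / 2)) : ℂ)
      = ∏ k, (Real.exp (-(u ^ 2 * Var[X k; μ k] / 2)) : ℂ) := by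
    rw [← Complex.ofReal_prod, ← Real.exp_sum, Finset.mul_sum, Finset.sum_div,
      Finset.sum_neg_distrib]
  rw [e]
  refine (norm_prod_sub_prod_le _ _ _ ?_ ?_).trans ?_
  · intro k
    refine (norm_integral_le_integral_norm _).trans ?_
    simp only [Complex.norm_exp_ofReal_mul_I]
    simp
  · intro k
    rw [Complex.norm_real, Real.norm_eq_abs, abs_of_pos (Real.exp_pos _), Real.exp_le_one_iff]
    have := variance_nonneg (X k) (μ k)
    have : 0 ≤ u ^ 2 * Var[X k; μ k] / 2 := by positivity
    linarith
  · refine (Finset.sum_le_sum fun k _ => norm_charFun_sub_gaussian_le (μ k) (X k) u).trans ?_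
    rw [Finset.sum_add_distrib, ← Finset.mul_sum, ← Finset.mul_sum, Finset.sum_add_distrib,
      ← Finset.mul_sum]
    have : 5 * |u| ^ 3 * (∑ k : Fin n, (1:ℝ) + 16 * ∑ k, ∫ ω, X k ω ^ 4 ∂(μ k))
        ≤ 5 * |u| ^ 3 * (n * (1 + 16 * C)) := by
      gcongr
      simp only [Finset.sum_const, Finset.card_univ, Fintype.card_fin, nsmul_eq_mul, mul_one]
      linarith
    have : u ^ 4 * ∑ k, ∫ ω, X k ω ^ 4 ∂(μ k) ≤ u ^ 4 * (C * n) := by gcongr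
    linarith

end Moments

section CLT

/-! ### A central limit theorem for triangular arrays -/

variable {Ω : Type*} [Fintype Ω] [MeasurableSpace Ω] [MeasurableSingletonClass Ω]

/-- The second moments, not the variances, are used for normalization, so that the limit variance
`r` need not be `1`: only the total mean is assumed to vanish. -/
theorem tendsto_charFun_normalized_sum (N : ℕ → ℕ) (hN : Tendsto N atTop atTop)
    (μ : ∀ i, Fin (N i) → Measure Ω) [∀ i k, IsProbabilityMeasure (μ i k)]
    (X : ∀ i, Fin (N i) → Ω → ℝ) {c C : ℝ} (hc : 0 < c) {r : ℝ}
    (h0 : ∀ᶠ i in atTop, ∑ k, ∫ ω, X i k ω ∂(μ i k) = 0)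
    (h4 : ∀ᶠ i in atTop, ∑ k, ∫ ω, X i k ω ^ 4 ∂(μ i k) ≤ C * N i)
    (h2 : ∀ᶠ i in atTop, c * N i ≤ ∑ k, ∫ ω, X i k ω ^ 2 ∂(μ i k))
    (hr : Tendsto (fun i => (∑ k, Var[X i k; μ i k]) / ∑ k, ∫ ω, X i k ω ^ 2 ∂(μ i k)) atTop
      (𝓝 r)) (t : ℝ) :
    Tendsto (fun i => ∫ ω, Complex.exp ((t / √(∑ k, ∫ ω, X i k ω ^ 2 ∂(μ i k))
      * ∑ k, X i k (ω k) : ℝ) * Complex.I) ∂(Measure.pi (μ i))) atTop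
      (𝓝 (Real.exp (-(t ^ 2 * r / 2)) : ℂ)) := by
  set q : ℕ → ℝ := fun i => ∑ k, ∫ ω, X i k ω ^ 2 ∂(μ i k) with hq
  set u : ℕ → ℝ := fun i => t / √(q i) with hu
  have hq0 : ∀ i, 0 ≤ q i := fun i => Finset.sum_nonneg fun k _ => integral_nonneg fun ω =>
    sq_nonneg _
  have hu2 : ∀ i, u i ^ 2 = t ^ 2 / q i := fun i => by
    simp only [hu]
    rw [div_pow, Real.sq_sqrt (hq0 i)]
  have hNr : Tendsto (fun i => (N i : ℝ)) atTop atTop := tendsto_natCast_atTop_atTop.comp hN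
  have hqt : Tendsto q atTop atTop := tendsto_atTop_mono' _ h2 (hNr.const_mul_atTop hc)
  have hut : Tendsto u atTop (𝓝 0) :=
    (Real.tendsto_sqrt_atTop.comp hqt).const_div_atTop t
  have hlim : Tendsto (fun i => (Real.exp (-(u i ^ 2 * (∑ k, Var[X i k; μ i k]) / 2)) : ℂ)) atTop
      (𝓝 (Real.exp (-(t ^ 2 * r / 2)) : ℂ)) := by
    refine (Complex.continuous_ofReal.tendsto _).comp ((Real.continuous_exp.tendsto _).comp ?_)
    have := ((hr.const_mul (t ^ 2)).div_const 2).neg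
    refine this.congr fun i => ?_
    rw [hu2]; ring
  have hun : ∀ᶠ i in atTop, u i ^ 2 * N i ≤ t ^ 2 / c := by
    filter_upwards [h2, hNr.eventually_gt_atTop 0] with i hi hNi
    rw [hu2]
    have hqi : 0 < q i := lt_of_lt_of_le (by positivity) hi
    rw [div_mul_eq_mul_div, div_le_div_iff₀ hqi hc]
    have := mul_le_mul_of_nonneg_left hi (sq_nonneg t)
    linarith
  refine tendsto_of_tendsto_of_dist hlim ?_
  -- As `u i → 0` while `u i ^ 2 * N i` stays bounded, both error terms vanish.
  have hbound : Tendsto (fun i => 5 * |u i| * (t ^ 2 / c) * (1 + 16 * |C|)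
      + |u i| ^ 2 * (t ^ 2 / c) * |C|) atTop (𝓝 0) := by
    have h1 : Tendsto (fun i => |u i|) atTop (𝓝 0) := by simpa using hut.abs
    have := ((((h1.const_mul 5).mul_const (t ^ 2 / c)).mul_const (1 + 16 * |C|))).add
      (((h1.pow 2).mul_const (t ^ 2 / c)).mul_const |C|)
    simpa using this
  refine squeeze_zero' (Eventually.of_forall fun _ => dist_nonneg) ?_ hbound
  filter_upwards [h0, h4, hun] with i hi0 hi4 hiu
  rw [dist_comm, dist_eq_norm]
  have hi4' : ∑ k, ∫ ω, X i k ω ^ 4 ∂(μ i k) ≤ |C| * N i :=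
    hi4.trans (by gcongr; exact le_abs_self C)
  refine (norm_integral_cexp_sum_sub_le (μ i) (X i) hi0 |C| hi4' (u i)).trans ?_
  have hau : |u i| ^ 2 = u i ^ 2 := sq_abs _
  have e1 : 5 * |u i| ^ 3 * (N i * (1 + 16 * |C|))
      = 5 * |u i| * (u i ^ 2 * N i) * (1 + 16 * |C|) := by rw [← hau]; ring
  have e2 : u i ^ 4 * (|C| * N i) = |u i| ^ 2 * (u i ^ 2 * N i) * |C| := by rw [hau]; ring
  rw [e1, e2]
  gcongr

end CLT

section SelfNormalized

/-! ### Self-normalized sums -/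

variable {Ω : Type*} [Fintype Ω] [MeasurableSpace Ω] [MeasurableSingletonClass Ω]

/-- Chebyshev's inequality for a sum of independent variables, with the variances bounded by second
moments. -/
theorem measureReal_abs_sum_sub_ge_le {n : ℕ} (μ : Fin n → Measure Ω)
    [∀ k, IsProbabilityMeasure (μ k)] (f : Fin n → Ω → ℝ) {a : ℝ} (ha : 0 < a) :
    (Measure.pi μ).real {ω | a ≤ |∑ k, f k (ω k) - ∑ k, ∫ x, f k x ∂(μ k)|}
      ≤ (∑ k, ∫ x, f k x ^ 2 ∂(μ k)) / a ^ 2 := by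
  have hL : MemLp (∑ k, fun ω : Fin n → Ω => f k (ω k)) 2 (Measure.pi μ) := MemLp.of_discrete
  have hmean : ∫ ω, (∑ k, fun ω : Fin n → Ω => f k (ω k)) ω ∂(Measure.pi μ)
      = ∑ k, ∫ x, f k x ∂(μ k) := by
    simp only [Finset.sum_apply]
    rw [integral_finsetSum _ fun _ _ => Integrable.of_finite]
    refine Finset.sum_congr rfl fun k _ => ?_
    exact integral_comp_eval (AEStronglyMeasurable.of_discrete)
  have h := meas_ge_le_variance_div_sq hL ha
  rw [hmean, variance_sum_pi fun k => memLp_of_fintype (μ k) (f k) 2] at h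
  have hv : ∑ k, Var[f k; μ k] ≤ ∑ k, ∫ x, f k x ^ 2 ∂(μ k) :=
    Finset.sum_le_sum fun k _ => by
      rw [variance_eq_sub (memLp_of_fintype (μ k) (f k) 2)]
      simpa using sq_nonneg _
  have hv0 : 0 ≤ ∑ k, ∫ x, f k x ^ 2 ∂(μ k) :=
    Finset.sum_nonneg fun k _ => integral_nonneg fun x => sq_nonneg _
  refine ENNReal.toReal_le_of_le_ofReal (by positivity) ?_
  simp only [Finset.sum_apply] at h
  refine h.trans (ENNReal.ofReal_le_ofReal ?_)
  gcongr

theorem continuous_cdf (μ : Measure ℝ) [IsProbabilityMeasure μ] [NullSingletonClass μ] :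
    Continuous (cdf μ) := by
  rw [continuous_iff_continuousAt]
  intro x
  rw [(monotone_cdf μ).continuousAt_iff_leftLim_eq_rightLim, StieltjesFunction.rightLim_eq]
  have h := (cdf μ).measure_singleton x
  rw [measure_cdf, measure_singleton, eq_comm, ENNReal.ofReal_eq_zero] at h
  exact le_antisymm ((monotone_cdf μ).leftLim_le le_rfl) (by linarith)

theorem measureReal_Ici_eq (μ : Measure ℝ) [IsProbabilityMeasure μ] [NullSingletonClass μ] (s : ℝ) :
    μ.real (Set.Ici s) = 1 - cdf μ s := by
  have h : Set.Ici s = (Set.Iio s)ᶜ := by simp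
  rw [h, probReal_compl_eq_one_sub measurableSet_Iio, cdf_eq_real, measureReal_congr Iio_ae_eq_Iic]

theorem continuous_measureReal_Ici (μ : Measure ℝ) [IsProbabilityMeasure μ]
    [NullSingletonClass μ] : Continuous fun s => μ.real (Set.Ici s) := by
  simp only [measureReal_Ici_eq]
  exact continuous_const.sub (continuous_cdf μ)

theorem exists_measureReal_Ici_sub_le (μ : Measure ℝ) [IsProbabilityMeasure μ]
    [NullSingletonClass μ] (s : ℝ) {ε : ℝ} (hε : 0 < ε) :
    ∃ η > 0, μ.real (Set.Ici (s - η)) ≤ μ.real (Set.Ici s) + ε := by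
  obtain ⟨d, hd, h⟩ := Metric.continuousAt_iff.1
    ((continuous_measureReal_Ici μ).continuousAt (x := s)) ε hε
  refine ⟨d / 2, by positivity, ?_⟩
  have h1 := h (x := s - d / 2) (by
    rw [Real.dist_eq, show s - d / 2 - s = -(d / 2) by ring, abs_neg, abs_of_pos (by positivity)]
    linarith)
  rw [Real.dist_eq] at h1
  linarith [(abs_lt.1 h1).2]

/-- A sum of independent variables divided by the square root of the sum of their squares (equal to
`0` if all of them vanish). -/
noncomputable def selfNormalized {n : ℕ} (X : Fin n → Ω → ℝ) (ω : Fin n → Ω) : ℝ :=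
  (∑ k, X k (ω k)) / √(∑ k, X k (ω k) ^ 2)

/-- If `V` is close to `q`, then a large value of `S / √V` forces one of `S / √q`. -/
theorem le_div_sqrt_of_abs_sub_lt {S V q s δ η : ℝ} (hq : 0 < q) (hδ1 : δ ≤ 1)
    (hη : |s| * δ ≤ η) (hV : |V - q| < δ * q) (hs : s ≤ S / √V) : s - η ≤ S / √q := by
  have hVpos : 0 < V := by
    have := (abs_lt.1 hV).1
    nlinarith
  have hsV := Real.sqrt_pos.2 hVpos
  have hsq := Real.sqrt_pos.2 hq
  set ρ := √V / √q with hρ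
  have hρ0 : 0 < ρ := by positivity
  have hρ2 : ρ ^ 2 = V / q := by
    rw [hρ, div_pow, Real.sq_sqrt hVpos.le, Real.sq_sqrt hq.le]
  have h1 : |ρ - 1| ≤ δ := by
    have h2 : |ρ ^ 2 - 1| < δ := by
      rw [hρ2]
      have e : V / q - 1 = (V - q) / q := by field_simp
      rw [e, abs_div, abs_of_pos hq, div_lt_iff₀ hq]
      exact hV
    have h3 : |ρ ^ 2 - 1| = |ρ - 1| * (ρ + 1) := by
      rw [show ρ ^ 2 - 1 = (ρ - 1) * (ρ + 1) by ring, abs_mul, abs_of_pos (by linarith : 0 < ρ + 1)]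
    nlinarith [abs_nonneg (ρ - 1)]
  have h4 : s * ρ ≤ S / √q := by
    rw [le_div_iff₀ hsV] at hs
    rw [hρ, le_div_iff₀ hsq]
    calc s * (√V / √q) * √q = s * √V := by field_simp
      _ ≤ S := hs
  have h5 : |s * (ρ - 1)| ≤ η := by
    rw [abs_mul]
    exact (mul_le_mul_of_nonneg_left h1 (abs_nonneg s)).trans hη
  have := (abs_le.1 h5).1
  linarith

theorem eventually_measureReal_normalized_ge_le (N : ℕ → ℕ) (hN : Tendsto N atTop atTop)
    (μ : ∀ i, Fin (N i) → Measure Ω) [∀ i k, IsProbabilityMeasure (μ i k)]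
    (X : ∀ i, Fin (N i) → Ω → ℝ) {c C : ℝ} (hc : 0 < c) {r : ℝ≥0}
    (h0 : ∀ᶠ i in atTop, ∑ k, ∫ ω, X i k ω ∂(μ i k) = 0)
    (h4 : ∀ᶠ i in atTop, ∑ k, ∫ ω, X i k ω ^ 4 ∂(μ i k) ≤ C * N i)
    (h2 : ∀ᶠ i in atTop, c * N i ≤ ∑ k, ∫ ω, X i k ω ^ 2 ∂(μ i k))
    (hr : Tendsto (fun i => (∑ k, Var[X i k; μ i k]) / ∑ k, ∫ ω, X i k ω ^ 2 ∂(μ i k)) atTop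
      (𝓝 r)) (s : ℝ) {ε : ℝ} (hε : 0 < ε) :
    ∀ᶠ i in atTop, (Measure.pi (μ i)).real
      {ω | s ≤ (∑ k, X i k (ω k)) / √(∑ k, ∫ ω, X i k ω ^ 2 ∂(μ i k))}
        ≤ (gaussianReal 0 r).real (Set.Ici s) + ε := by
  set W : ∀ i, (Fin (N i) → Ω) → ℝ := fun i ω =>
    (∑ k, X i k (ω k)) / √(∑ k, ∫ ω, X i k ω ^ 2 ∂(μ i k)) with hW
  have hWm : ∀ i, Measurable (W i) := fun i => Measurable.of_discrete
  let P : ℕ → ProbabilityMeasure ℝ := fun i =>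
    ⟨(Measure.pi (μ i)).map (W i), Measure.isProbabilityMeasure_map (hWm i).aemeasurable⟩
  let G : ProbabilityMeasure ℝ := ⟨gaussianReal 0 r, inferInstance⟩
  have hlim : Tendsto P atTop (𝓝 G) := by
    refine ProbabilityMeasure.tendsto_iff_tendsto_charFun.2 fun t => ?_
    have h := tendsto_charFun_normalized_sum N hN μ X hc h0 h4 h2 hr t
    have e : charFun (G : Measure ℝ) t = (Real.exp (-(t ^ 2 * (r : ℝ) / 2)) : ℂ) := by
      change charFun (gaussianReal 0 r) t = _
      rw [charFun_gaussianReal]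
      push_cast
      congr 1
      ring
    rw [e]
    refine h.congr fun i => ?_
    change _ = charFun ((Measure.pi (μ i)).map (W i)) t
    rw [charFun_apply_real, integral_map (hWm i).aemeasurable (by fun_prop)]
    congr 1; ext ω
    congr 2
    simp only [hW]
    push_cast
    ring
  have hls := ProbabilityMeasure.limsup_measure_closed_le_of_tendsto hlim
    (isClosed_Ici (a := s))
  have hlt : limsup (fun i => (P i : Measure ℝ) (Set.Ici s)) atTop
      < ENNReal.ofReal ((gaussianReal 0 r).real (Set.Ici s) + ε) := by
    refine hls.trans_lt ?_
    rw [← ofReal_measureReal (μ := (G : Measure ℝ))]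
    exact (ENNReal.ofReal_lt_ofReal_iff (by positivity)).2 (lt_add_of_pos_right _ hε)
  filter_upwards [eventually_lt_of_limsup_lt hlt] with i hi
  have e : (P i : Measure ℝ) (Set.Ici s) = Measure.pi (μ i) {ω | s ≤ W i ω} := by
    change (Measure.pi (μ i)).map (W i) _ = _
    rw [Measure.map_apply (hWm i) measurableSet_Ici]
    rfl
  rw [e] at hi
  exact ENNReal.toReal_le_of_le_ofReal (by positivity) hi.le

/-- Upper tails in the central limit theorem for self-normalized sums, along a sequence. -/
theorem eventually_selfNormalized_tail_le_seq (N : ℕ → ℕ) (hN : Tendsto N atTop atTop)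
    (μ : ∀ i, Fin (N i) → Measure Ω) [∀ i k, IsProbabilityMeasure (μ i k)]
    (X : ∀ i, Fin (N i) → Ω → ℝ) {c C : ℝ} (hc : 0 < c) {r : ℝ≥0} (hr0 : r ≠ 0)
    (h0 : ∀ᶠ i in atTop, ∑ k, ∫ ω, X i k ω ∂(μ i k) = 0)
    (h4 : ∀ᶠ i in atTop, ∑ k, ∫ ω, X i k ω ^ 4 ∂(μ i k) ≤ C * N i)
    (h2 : ∀ᶠ i in atTop, c * N i ≤ ∑ k, ∫ ω, X i k ω ^ 2 ∂(μ i k))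
    (hr : Tendsto (fun i => (∑ k, Var[X i k; μ i k]) / ∑ k, ∫ ω, X i k ω ^ 2 ∂(μ i k)) atTop
      (𝓝 r)) (s : ℝ) {ε : ℝ} (hε : 0 < ε) :
    ∀ᶠ i in atTop, (Measure.pi (μ i)).real {ω | s ≤ selfNormalized (X i) ω}
        ≤ (gaussianReal 0 r).real (Set.Ici s) + ε := by
  have := nullSingletonClass_gaussianReal (μ := 0) hr0
  obtain ⟨η, hη, hηs⟩ := exists_measureReal_Ici_sub_le (gaussianReal 0 r) s
    (show 0 < ε / 3 by positivity)
  set δ : ℝ := min 1 (η / (|s| + 1)) with hδ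
  have hs1 : 0 < |s| + 1 := by positivity
  have hδ0 : 0 < δ := lt_min one_pos (by positivity)
  have hδη : |s| * δ ≤ η := by
    calc |s| * δ ≤ (|s| + 1) * (η / (|s| + 1)) := by
          gcongr
          · linarith
          · exact min_le_right _ _
      _ = η := by field_simp
  have hNr : Tendsto (fun i => (N i : ℝ)) atTop atTop := tendsto_natCast_atTop_atTop.comp hN
  have hcheb : ∀ᶠ i in atTop, |C| / (δ ^ 2 * c ^ 2) / (N i : ℝ) < ε / 3 := by
    have : Tendsto (fun i => |C| / (δ ^ 2 * c ^ 2) / (N i : ℝ)) atTop (𝓝 0) :=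
      hNr.const_div_atTop _
    exact this.eventually_lt_const (by positivity)
  filter_upwards [eventually_measureReal_normalized_ge_le N hN μ X hc h0 h4 h2 hr (s - η)
    (ε := ε / 3) (by positivity), hcheb, h4, h2, hNr.eventually_gt_atTop 0] with i hi hiN hi4 hi2 hNi
  set q := ∑ k, ∫ ω, X i k ω ^ 2 ∂(μ i k) with hq
  have hq0 : 0 < q := lt_of_lt_of_le (by positivity) hi2
  have hsub : {ω | s ≤ selfNormalized (X i) ω} ⊆
      {ω | s - η ≤ (∑ k, X i k (ω k)) / √q} ∪ {ω | δ * q ≤ |∑ k, X i k (ω k) ^ 2 - q|} := by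
    intro ω hω
    by_cases h : δ * q ≤ |∑ k, X i k (ω k) ^ 2 - q|
    · exact Or.inr h
    · exact Or.inl (le_div_sqrt_of_abs_sub_lt hq0 (min_le_left _ _) hδη (not_le.1 h) hω)
  have hch := measureReal_abs_sum_sub_ge_le (μ i) (fun k ω => X i k ω ^ 2) (a := δ * q)
    (by positivity)
  have hch2 : (∑ k, ∫ x, (X i k x ^ 2) ^ 2 ∂(μ i k)) / (δ * q) ^ 2 ≤ ε / 3 := by
    refine le_trans ?_ hiN.le
    simp only [← pow_mul]
    calc (∑ k, ∫ x, X i k x ^ (2 * 2) ∂(μ i k)) / (δ * q) ^ 2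
        ≤ |C| * N i / (δ * (c * N i)) ^ 2 := by
          gcongr
          exact hi4.trans (by gcongr; exact le_abs_self C)
      _ = |C| / (δ ^ 2 * c ^ 2) / (N i : ℝ) := by field_simp
  have := (measureReal_mono hsub).trans (measureReal_union_le (μ := Measure.pi (μ i)) _ _)
  linarith

/-- Upper tails in the central limit theorem for self-normalized sums of a triangular array. The
limit variance `r` is smaller than `1` when the summands are not individually centred. -/
theorem eventually_selfNormalized_tail_le {ι : Type*} {l : Filter ι} [l.IsCountablyGenerated]
    (N : ι → ℕ) (hN : Tendsto N l atTop)
    (μ : ∀ i, Fin (N i) → Measure Ω) [∀ i k, IsProbabilityMeasure (μ i k)]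
    (X : ∀ i, Fin (N i) → Ω → ℝ) {c C : ℝ} (hc : 0 < c) {r : ℝ≥0} (hr0 : r ≠ 0)
    (h0 : ∀ᶠ i in l, ∑ k, ∫ ω, X i k ω ∂(μ i k) = 0)
    (h4 : ∀ᶠ i in l, ∑ k, ∫ ω, X i k ω ^ 4 ∂(μ i k) ≤ C * N i)
    (h2 : ∀ᶠ i in l, c * N i ≤ ∑ k, ∫ ω, X i k ω ^ 2 ∂(μ i k))
    (hr : Tendsto (fun i => (∑ k, Var[X i k; μ i k]) / ∑ k, ∫ ω, X i k ω ^ 2 ∂(μ i k)) l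
      (𝓝 r)) (s : ℝ) {ε : ℝ} (hε : 0 < ε) :
    ∀ᶠ i in l, (Measure.pi (μ i)).real {ω | s ≤ selfNormalized (X i) ω}
        ≤ (gaussianReal 0 r).real (Set.Ici s) + ε := by
  rw [eventually_iff_seq_eventually]
  intro x hx
  exact eventually_selfNormalized_tail_le_seq (fun n => N (x n)) (hN.comp hx) (fun n => μ (x n))
    (fun n => X (x n)) hc hr0 (hx.eventually h0) (hx.eventually h4) (hx.eventually h2)
    (hr.comp hx) s hε

end SelfNormalized

section Averages

/-! ### Averages under weak convergence of empirical measures -/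

variable {E : Type*} [TopologicalSpace E] [MeasurableSpace E] [OpensMeasurableSpace E]

theorem tendsto_average_of_bounded (x : ∀ J : ℕ, Fin J → E) (ν : ProbabilityMeasure E)
    (h : Tendsto (fun J : ℕ => (J : ℝ≥0)⁻¹ • ∑ j, (diracProba (x J j)).toFiniteMeasure) atTop
      (𝓝 ν.toFiniteMeasure)) (f : BoundedContinuousFunction E ℝ) :
    Tendsto (fun J : ℕ => (∑ j, f (x J j)) / (J : ℝ)) atTop (𝓝 (∫ y, f y ∂(ν : Measure E))) := by
  have h1 := (FiniteMeasure.tendsto_iff_forall_integral_tendsto.1 h) f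
  refine h1.congr fun J => ?_
  rw [FiniteMeasure.toMeasure_smul, FiniteMeasure.toMeasure_sum, integral_smul_nnreal_measure,
    integral_finsetSum_measure fun j _ => f.integrable _]
  have : ∀ j, ∫ y, f y ∂(((diracProba (x J j)).toFiniteMeasure : FiniteMeasure E) : Measure E)
      = f (x J j) := fun j =>
    integral_dirac' _ _ f.continuous.measurable.stronglyMeasurable
  simp only [this]
  rw [NNReal.smul_def, smul_eq_mul, div_eq_inv_mul]
  simp

/-- Averages of a continuous function converge to its integral against the weak limit of the
empirical measures, if the averages of its square are bounded (uniform integrability). -/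
theorem tendsto_average (x : ∀ J : ℕ, Fin J → E) (ν : ProbabilityMeasure E)
    (h : Tendsto (fun J : ℕ => (J : ℝ≥0)⁻¹ • ∑ j, (diracProba (x J j)).toFiniteMeasure) atTop
      (𝓝 ν.toFiniteMeasure)) (f : E → ℝ) (hf : Continuous f) (hf0 : ∀ y, 0 ≤ f y) {C : ℝ}
    (hC : ∀ᶠ J : ℕ in atTop, ∑ j, f (x J j) ^ 2 ≤ C * J) :
    Tendsto (fun J : ℕ => (∑ j, f (x J j)) / (J : ℝ)) atTop (𝓝 (∫ y, f y ∂(ν : Measure E))) := by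
  -- Truncation at level `n` costs at most `f ^ 2 / n` at each point.
  let g : ℕ → BoundedContinuousFunction E ℝ := fun n =>
    BoundedContinuousFunction.ofNormedAddCommGroup (fun y => min (f y) n)
      (hf.min continuous_const) n fun y => by
        rw [Real.norm_eq_abs, abs_of_nonneg (le_min (hf0 y) (Nat.cast_nonneg n))]
        exact min_le_right _ _
  have hg : ∀ n y, g n y = min (f y) n := fun n y => rfl
  have hlim : ∀ n, Tendsto (fun J : ℕ => (∑ j, g n (x J j)) / (J : ℝ)) atTop
      (𝓝 (∫ y, g n y ∂(ν : Measure E))) := fun n => tendsto_average_of_bounded x ν h (g n)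
  have hgbd : ∀ n, ∫ y, g n y ∂(ν : Measure E) ≤ 1 + C := fun n => by
    refine le_of_tendsto (hlim n) ?_
    filter_upwards [hC, eventually_gt_atTop 0] with J hJ hJ0
    have hJ0' : (0 : ℝ) < J := by exact_mod_cast hJ0
    rw [div_le_iff₀ hJ0']
    calc ∑ j, g n (x J j) ≤ ∑ j, (1 + f (x J j) ^ 2) := Finset.sum_le_sum fun j _ => by
          rw [hg]
          refine (min_le_left _ _).trans ?_
          nlinarith [sq_nonneg (f (x J j) - 1), sq_nonneg (f (x J j))]
      _ ≤ (1 + C) * J := by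
          rw [Finset.sum_add_distrib]
          simp only [Finset.sum_const, Finset.card_univ, Fintype.card_fin, nsmul_eq_mul, mul_one]
          linarith
  have hgf : ∀ y, Tendsto (fun n => g n y) atTop (𝓝 (f y)) := fun y => by
    refine tendsto_const_nhds.congr' ?_
    obtain ⟨K, hK⟩ := exists_nat_ge (f y)
    filter_upwards [eventually_ge_atTop K] with n hn
    rw [hg, min_eq_left (hK.trans (by exact_mod_cast hn))]
  have hint : Integrable f (ν : Measure E) := by
    refine ⟨hf.measurable.aestronglyMeasurable, ?_⟩
    rw [hasFiniteIntegral_iff_ofReal (Eventually.of_forall hf0)]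
    have hF : ∫⁻ y, ENNReal.ofReal (f y) ∂(ν : Measure E)
        ≤ liminf (fun n => ∫⁻ y, ENNReal.ofReal (g n y) ∂(ν : Measure E)) atTop := by
      refine le_trans (le_of_eq ?_) (lintegral_liminf_le fun n =>
        (g n).continuous.measurable.ennreal_ofReal)
      congr 1; ext y
      exact (((ENNReal.continuous_ofReal.tendsto _).comp (hgf y)).liminf_eq).symm
    refine hF.trans_lt (lt_of_le_of_lt ?_ (ENNReal.ofReal_lt_top (r := 1 + C)))
    refine liminf_le_of_frequently_le' (Eventually.of_forall fun n => ?_).frequently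
    rw [← ofReal_integral_eq_lintegral_ofReal ((g n).integrable _)
      (Eventually.of_forall fun y => le_min (hf0 y) (Nat.cast_nonneg n))]
    exact ENNReal.ofReal_le_ofReal (hgbd n)
  have hgint : Tendsto (fun n => ∫ y, g n y ∂(ν : Measure E)) atTop
      (𝓝 (∫ y, f y ∂(ν : Measure E))) := by
    refine tendsto_integral_of_dominated_convergence f
      (fun n => (g n).continuous.measurable.aestronglyMeasurable) hint
      (fun n => Eventually.of_forall fun y => ?_) (Eventually.of_forall hgf)
    rw [Real.norm_eq_abs, hg, abs_of_nonneg (le_min (hf0 y) (Nat.cast_nonneg n))]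
    exact min_le_left _ _
  refine Metric.tendsto_nhds.2 fun ε hε => ?_
  have hK : Tendsto (fun n : ℕ => |C| / (n : ℝ)) atTop (𝓝 0) :=
    tendsto_natCast_atTop_atTop.const_div_atTop _
  obtain ⟨n, hn1, hn2, hn0⟩ := ((hK.eventually_lt_const (show 0 < ε / 3 by positivity)).and
    ((Metric.tendsto_nhds.1 hgint (ε / 3) (by positivity)).and (eventually_gt_atTop 0))).exists
  have hn0' : (0 : ℝ) < n := by exact_mod_cast hn0
  filter_upwards [Metric.tendsto_nhds.1 (hlim n) (ε / 3) (by positivity), hC,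
    eventually_gt_atTop 0] with J hJ1 hJC hJ0
  have hJ0' : (0 : ℝ) < J := by exact_mod_cast hJ0
  have hd : dist ((∑ j, f (x J j)) / (J : ℝ)) ((∑ j, g n (x J j)) / (J : ℝ)) < ε / 3 := by
    rw [Real.dist_eq, ← sub_div, ← Finset.sum_sub_distrib, abs_of_nonneg]
    · refine lt_of_le_of_lt ?_ hn1
      rw [div_le_div_iff₀ hJ0' hn0', Finset.sum_mul]
      calc ∑ j, (f (x J j) - g n (x J j)) * n ≤ ∑ j, f (x J j) ^ 2 :=
            Finset.sum_le_sum fun j _ => by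
              rw [hg]
              have h0 := hf0 (x J j)
              rcases le_total (f (x J j)) n with h | h
              · rw [min_eq_left h]; nlinarith
              · rw [min_eq_right h]; nlinarith
        _ ≤ |C| * J := hJC.trans (by gcongr; exact le_abs_self C)
    · refine div_nonneg (Finset.sum_nonneg fun j _ => ?_) hJ0'.le
      rw [hg]
      exact sub_nonneg.2 (min_le_left _ _)
  calc _ ≤ dist _ ((∑ j, g n (x J j)) / (J : ℝ)) + (dist _ (∫ y, g n y ∂(ν : Measure E))
        + dist _ _) := (dist_triangle _ _ _).trans (by gcongr; exact dist_triangle _ _ _)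
    _ < ε := by linarith

end Averages

section Binomial

/-! ### Binomial tails and Monte Carlo tests -/

/-- The probability that a binomial variable with parameters `M` and `u` is less than `k`. -/
noncomputable def binomialTail (M k : ℕ) (u : ℝ) : ℝ :=
  ∑ i ∈ Finset.range k, (M.choose i : ℝ) * u ^ i * (1 - u) ^ (M - i)

/-- The density of the beta distribution with parameters `k` and `M - k + 1`, that is, of the `k`-th
smallest of `M` independent uniform variables (for `1 ≤ k ≤ M`). -/
noncomputable def betaDensity (M k : ℕ) (v : ℝ) : ℝ :=
  k * M.choose k * v ^ (k - 1) * (1 - v) ^ (M - k)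

theorem continuous_betaDensity (M k : ℕ) : Continuous (betaDensity M k) := by
  unfold betaDensity
  fun_prop

theorem betaDensity_nonneg (M k : ℕ) {v : ℝ} (h0 : 0 ≤ v) (h1 : v ≤ 1) : 0 ≤ betaDensity M k v := by
  have : 0 ≤ 1 - v := by linarith
  unfold betaDensity
  positivity

theorem hasDerivAt_binomialTail (M k : ℕ) (u : ℝ) :
    HasDerivAt (binomialTail M k) (-betaDensity M k u) u := by
  induction k with
  | zero =>
    have : binomialTail M 0 = fun _ => 0 := by ext; simp [binomialTail]
    rw [this]
    simpa [betaDensity] using hasDerivAt_const u (0 : ℝ)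
  | succ k ih =>
    have e : binomialTail M (k + 1)
        = fun u => binomialTail M k u + (M.choose k : ℝ) * u ^ k * (1 - u) ^ (M - k) := by
      ext u; simp [binomialTail, Finset.sum_range_succ]
    rw [e]
    have h1 : HasDerivAt (fun u : ℝ => (M.choose k : ℝ) * u ^ k)
        ((M.choose k : ℝ) * (k * u ^ (k - 1))) u := (hasDerivAt_pow k u).const_mul _
    have h2 : HasDerivAt (fun u : ℝ => (1 - u) ^ (M - k))
        (((M - k : ℕ) : ℝ) * (1 - u) ^ (M - k - 1) * (-1)) u := by
      exact ((hasDerivAt_id' u).const_sub 1).fun_pow (M - k)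
    refine (ih.add (h1.mul h2)).congr_deriv ?_
    have hch : (M.choose (k + 1) : ℝ) * (k + 1) = M.choose k * ((M - k : ℕ) : ℝ) := by
      exact_mod_cast Nat.choose_succ_right_eq M k
    simp only [betaDensity, Nat.add_sub_cancel, ← Nat.sub_sub, Nat.cast_add, Nat.cast_one]
    linear_combination (u ^ k * (1 - u) ^ (M - k - 1)) * hch

theorem binomialTail_zero {M k : ℕ} (hk : 1 ≤ k) : binomialTail M k 0 = 1 := by
  unfold binomialTail
  rw [Finset.sum_eq_single 0]
  · simp
  · intro i _ hi; simp [hi]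
  · intro h; simp at h; omega

theorem binomialTail_one {M k : ℕ} (hk : k ≤ M) : binomialTail M k 1 = 0 := by
  refine Finset.sum_eq_zero fun i hi => ?_
  have : M - i ≠ 0 := by have := Finset.mem_range.1 hi; omega
  simp [this]

theorem integral_betaDensity_eq_sub (M k : ℕ) (a b : ℝ) :
    ∫ v in a..b, betaDensity M k v = binomialTail M k a - binomialTail M k b := by
  have h := intervalIntegral.integral_eq_sub_of_hasDerivAt (a := a) (b := b)
    (fun x _ => (hasDerivAt_binomialTail M k x).neg)
    (by simpa using (continuous_betaDensity M k).intervalIntegrable a b)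
  simp only [neg_neg, Pi.neg_apply] at h
  rw [h]; ring

theorem integral_betaDensity {M k : ℕ} (hk : 1 ≤ k) (hkM : k ≤ M) :
    ∫ v in (0 : ℝ)..1, betaDensity M k v = 1 := by
  rw [integral_betaDensity_eq_sub, binomialTail_zero hk, binomialTail_one hkM, sub_zero]

/-- The mean of the beta distribution with parameters `k` and `M - k + 1`. -/
theorem integral_betaDensity_mul_id {M k : ℕ} (hk : 1 ≤ k) (hkM : k ≤ M) :
    ∫ v in (0 : ℝ)..1, betaDensity M k v * v = k / (M + 1) := by
  have e : ∀ v, betaDensity M k v * v = k / (M + 1) * betaDensity (M + 1) (k + 1) v := by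
    intro v
    have hch : ((M : ℝ) + 1) * M.choose k = (M + 1).choose (k + 1) * (k + 1) := by
      exact_mod_cast Nat.add_one_mul_choose_eq M k
    obtain ⟨j, rfl⟩ : ∃ j, k = j + 1 := ⟨k - 1, by omega⟩
    have hM : (M : ℝ) + 1 ≠ 0 := by positivity
    simp only [betaDensity, Nat.add_sub_cancel, Nat.add_sub_add_right]
    push_cast at hch ⊢
    field_simp
    linear_combination (v ^ (j + 1) * (1 - v) ^ (M - (j + 1))) * hch
  simp only [e]
  rw [intervalIntegral.integral_const_mul, integral_betaDensity (by omega) (by omega), mul_one]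

theorem betaDensity_one_sub_le {M k : ℕ} (hk : 1 ≤ k) (hkM : 2 * k ≤ M + 1) {v : ℝ} (h0 : 0 ≤ v)
    (h1 : v ≤ 1 / 2) : betaDensity M k (1 - v) ≤ betaDensity M k v := by
  obtain ⟨d, hd⟩ : ∃ d, M - k = (k - 1) + d := ⟨M - k - (k - 1), by omega⟩
  have h2 : 0 ≤ 1 - v := by linarith
  have h3 : v ^ d ≤ (1 - v) ^ d := pow_le_pow_left₀ h0 (by linarith) d
  unfold betaDensity
  rw [hd, sub_sub_cancel, pow_add, pow_add]
  have h4 : 0 ≤ (k : ℝ) * M.choose k * v ^ (k - 1) * (1 - v) ^ (k - 1) := by positivity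
  calc _ = (k : ℝ) * M.choose k * v ^ (k - 1) * (1 - v) ^ (k - 1) * v ^ d := by ring
    _ ≤ (k : ℝ) * M.choose k * v ^ (k - 1) * (1 - v) ^ (k - 1) * (1 - v) ^ d := by gcongr
    _ = _ := by ring

/-- A distribution function `F` on `[0, 1]` that lies below that of the uniform distribution on
`[0, 1 / 2]` and is symmetric has, against a beta density with more mass on `[0, 1 / 2]`, a smaller
integral than the uniform one: pairing `v` with `1 - v` makes the difference of the integrands
nonnegative. -/
theorem integral_betaDensity_mul_le {M k : ℕ} (hk : 1 ≤ k) (hkM : 2 * k ≤ M + 1) {F : ℝ → ℝ}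
    (hF : Continuous F) (hle : ∀ v, 0 ≤ v → v ≤ 1 / 2 → F v ≤ v)
    (hsym : ∀ v, 0 ≤ v → v ≤ 1 → F v + F (1 - v) ≤ 1) :
    ∫ v in (0 : ℝ)..1, betaDensity M k v * F v ≤ k / (M + 1) := by
  have hb := continuous_betaDensity M k
  rw [← integral_betaDensity_mul_id hk (by omega)]
  set H : ℝ → ℝ := fun v => betaDensity M k v * (v - F v) with hH
  have hHc : Continuous H := hb.mul (continuous_id.sub hF)
  have hpos : ∀ v, 0 ≤ v → v ≤ 1 / 2 → 0 ≤ H v + H (1 - v) := by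
    intro v h0 h1
    have a1 := betaDensity_one_sub_le hk hkM h0 h1
    have a2 : 0 ≤ betaDensity M k (1 - v) := betaDensity_nonneg M k (by linarith) (by linarith)
    have a3 := hle v h0 h1
    have a4 := hsym v h0 (by linarith)
    simp only [hH]
    nlinarith [mul_nonneg (sub_nonneg.2 a1) (sub_nonneg.2 a3),
      mul_nonneg a2 (show 0 ≤ (v - F v) + (1 - v - F (1 - v)) by linarith)]
  have hrefl : ∫ v in (0 : ℝ)..1, H (1 - v) = ∫ v in (0 : ℝ)..1, H v := by
    simp
  have hHr : Continuous fun v => H (1 - v) := hHc.comp (continuous_const.sub continuous_id)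
  have hsum : 0 ≤ ∫ v in (0 : ℝ)..1, (H v + H (1 - v)) := by
    refine intervalIntegral.integral_nonneg zero_le_one fun v hv => ?_
    rcases le_total v (1 / 2) with h | h
    · exact hpos v hv.1 h
    · have := hpos (1 - v) (by linarith [hv.2]) (by linarith)
      rw [sub_sub_cancel] at this
      linarith
  rw [intervalIntegral.integral_add (hHc.intervalIntegrable _ _) (hHr.intervalIntegrable _ _),
    hrefl] at hsum
  have hdiff : ∫ v in (0 : ℝ)..1, H v = (∫ v in (0 : ℝ)..1, betaDensity M k v * v)
      - ∫ v in (0 : ℝ)..1, betaDensity M k v * F v := by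
    have c1 : Continuous fun v => betaDensity M k v * v := hb.mul continuous_id
    have c2 : Continuous fun v => betaDensity M k v * F v := hb.mul hF
    rw [← intervalIntegral.integral_sub (c1.intervalIntegrable _ _) (c2.intervalIntegrable _ _)]
    simp only [hH, mul_sub]
  linarith

/-- The rejection probability of a Monte Carlo test with `M` resamples, where `U` is the exact
resampling `p`-value: it is controlled by the distribution function of `U` alone, uniformly in
`M`. -/
theorem integral_binomialTail_le {Ω : Type*} [Fintype Ω] [MeasurableSpace Ω]
    [MeasurableSingletonClass Ω] (P : Measure Ω) [IsProbabilityMeasure P] (U : Ω → ℝ)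
    (hU0 : ∀ ω, 0 ≤ U ω) (hU1 : ∀ ω, U ω ≤ 1) {F : ℝ → ℝ}
    (hF : Continuous F) (hle : ∀ v, 0 ≤ v → v ≤ 1 / 2 → F v ≤ v)
    (hsym : ∀ v, 0 ≤ v → v ≤ 1 → F v + F (1 - v) ≤ 1) {ε : ℝ} (hε : 0 ≤ ε)
    (hP : ∀ v, 0 ≤ v → v ≤ 1 → P.real {ω | U ω ≤ v} ≤ F v + ε) {M k : ℕ} (hkM : 2 * k ≤ M + 1) :
    ∫ ω, binomialTail M k (U ω) ∂P ≤ k / (M + 1) + ε := by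
  rcases Nat.eq_zero_or_pos k with rfl | hk
  · simpa [binomialTail] using hε
  have hb := continuous_betaDensity M k
  have hbI : IntegrableOn (betaDensity M k) (Set.Ioc 0 1) :=
    (hb.intervalIntegrable 0 1).1
  have e1 : ∀ ω, binomialTail M k (U ω)
      = ∫ v in Set.Ioc (0 : ℝ) 1, (Set.Ioi (U ω)).indicator (betaDensity M k) v := by
    intro ω
    rw [setIntegral_indicator measurableSet_Ioi]
    have : Set.Ioc (0 : ℝ) 1 ∩ Set.Ioi (U ω) = Set.Ioc (U ω) 1 := by
      ext v
      simp only [Set.mem_inter_iff, Set.mem_Ioc, Set.mem_Ioi]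
      have := hU0 ω
      constructor
      · rintro ⟨⟨_, h⟩, h'⟩; exact ⟨h', h⟩
      · rintro ⟨h, h'⟩; exact ⟨⟨by linarith, h'⟩, h⟩
    rw [this, ← intervalIntegral.integral_of_le (hU1 ω), integral_betaDensity_eq_sub,
      binomialTail_one (by omega), sub_zero]
  have e2 : ∫ ω, binomialTail M k (U ω) ∂P
      = ∫ v in Set.Ioc (0 : ℝ) 1, betaDensity M k v * P.real {ω | U ω < v} := by
    rw [integral_fintype Integrable.of_finite]
    simp only [e1, smul_eq_mul, ← integral_const_mul]
    rw [← integral_finsetSum _ fun ω _ => (hbI.indicator measurableSet_Ioi).const_mul _]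
    congr 1; ext v
    have hm : P.real {ω | U ω < v} = ∫ ω, {ω | U ω < v}.indicator 1 ω ∂P :=
      (integral_indicator_one (Set.toFinite _).measurableSet).symm
    rw [hm, integral_fintype Integrable.of_finite, Finset.mul_sum]
    refine Finset.sum_congr rfl fun ω _ => ?_
    by_cases h : U ω < v
    · simp [Set.indicator, h]; ring
    · simp [Set.indicator, h]
  have hmono : Monotone fun v => P.real {ω | U ω < v} := fun a b hab =>
    measureReal_mono fun ω hω => lt_of_lt_of_le hω hab
  have hI1 : IntegrableOn (fun v => betaDensity M k v * P.real {ω | U ω < v}) (Set.Ioc 0 1) := by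
    refine hbI.mul_bdd (c := 1) hmono.measurable.aestronglyMeasurable
      (Eventually.of_forall fun v => ?_)
    rw [Real.norm_eq_abs, abs_of_nonneg measureReal_nonneg]
    exact measureReal_le_one
  rw [e2]
  calc ∫ v in Set.Ioc (0 : ℝ) 1, betaDensity M k v * P.real {ω | U ω < v}
      ≤ ∫ v in Set.Ioc (0 : ℝ) 1, betaDensity M k v * (F v + ε) := by
        refine setIntegral_mono_on hI1
          ((hb.mul (hF.add continuous_const)).intervalIntegrable 0 1).1 measurableSet_Ioc
          fun v hv => ?_
        refine mul_le_mul_of_nonneg_left ?_ (betaDensity_nonneg M k hv.1.le hv.2)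
        refine le_trans (measureReal_mono fun ω hω => ?_) (hP v hv.1.le hv.2)
        exact le_of_lt (show U ω < v from hω)
    _ = (∫ v in (0 : ℝ)..1, betaDensity M k v * F v) + ε := by
        rw [← intervalIntegral.integral_of_le zero_le_one]
        simp only [mul_add]
        have c1 : Continuous fun v => betaDensity M k v * F v := hb.mul hF
        have c2 : Continuous fun v => betaDensity M k v * ε := hb.mul continuous_const
        rw [intervalIntegral.integral_add (c1.intervalIntegrable _ _)
          (c2.intervalIntegrable _ _), intervalIntegral.integral_mul_const,
          integral_betaDensity hk (by omega), one_mul]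
    _ ≤ _ := by
        gcongr
        exact integral_betaDensity_mul_le hk hkM hF hle hsym

/-- The number of successes in `M` independent trials is binomial. -/
theorem pi_measureReal_card_lt {Ω : Type*} [Fintype Ω] [MeasurableSpace Ω]
    [MeasurableSingletonClass Ω] (P : Measure Ω) [IsProbabilityMeasure P] (A : Ω → Prop)
    [DecidablePred A] (M k : ℕ) :
    (Measure.pi fun _ : Fin M => P).real
        {zs | (Finset.univ.filter fun b => A (zs b)).card < k}
      = binomialTail M k (P.real {ω | A ω}) := by
  classical
  set u := P.real {ω | A ω} with hu
  have hbox : ∀ S : Finset (Fin M), (Measure.pi fun _ : Fin M => P).real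
      {zs | (Finset.univ.filter fun b => A (zs b)) = S} = u ^ S.card * (1 - u) ^ (M - S.card) := by
    intro S
    have e : {zs : Fin M → Ω | (Finset.univ.filter fun b => A (zs b)) = S}
        = Set.univ.pi fun b => if b ∈ S then {ω | A ω} else {ω | A ω}ᶜ := by
      ext zs
      simp only [Finset.ext_iff, Finset.mem_filter, Finset.mem_univ, true_and, Set.mem_ofPred_eq,
        Set.mem_univ_pi]
      refine forall_congr' fun b => ?_
      by_cases h : b ∈ S <;> simp [h]
    rw [e, measureReal_def, Measure.pi_pi, ENNReal.toReal_prod]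
    have h1 : ∀ b, (P (if b ∈ S then {ω | A ω} else {ω | A ω}ᶜ)).toReal
        = if b ∈ S then u else 1 - u := by
      intro b
      split_ifs
      · rfl
      · exact probReal_compl_eq_one_sub (Set.toFinite _).measurableSet
    simp only [h1]
    rw [Finset.prod_ite]
    have h2 : (Finset.univ.filter fun b => b ∈ S) = S := by ext; simp
    have h3 : (Finset.univ.filter fun b => b ∉ S) = Sᶜ := by ext; simp
    rw [h2, h3, Finset.prod_const, Finset.prod_const, Finset.card_compl, Fintype.card_fin]
  have hU : {zs : Fin M → Ω | (Finset.univ.filter fun b => A (zs b)).card < k}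
      = ⋃ S ∈ (Finset.univ : Finset (Finset (Fin M))).filter (fun S => S.card < k),
        {zs | (Finset.univ.filter fun b => A (zs b)) = S} := by
    ext zs; simp
  rw [hU, measureReal_biUnion_finset]
  · simp only [hbox]
    rw [Finset.sum_filter, ← Finset.powerset_univ, Finset.sum_powerset_apply_card
      (fun i => if i < k then u ^ i * (1 - u) ^ (M - i) else 0)]
    simp only [Finset.card_univ, Fintype.card_fin, nsmul_eq_mul, mul_ite, mul_zero]
    rw [← Finset.sum_filter]
    unfold binomialTail
    refine (Finset.sum_subset_zero_on_sdiff ?_ ?_ ?_)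
    · intro i hi
      simp only [Finset.mem_filter] at hi
      exact Finset.mem_range.2 hi.2
    · intro i hi
      simp only [Finset.mem_sdiff, Finset.mem_range, Finset.mem_filter, not_and] at hi
      have : M < i := by
        by_contra h
        exact hi.2 (by omega) hi.1
      simp [Nat.choose_eq_zero_of_lt this]
    · intro i _
      ring
  · intro S _ S' _ hne
    refine Set.disjoint_left.2 fun zs h h' => hne ?_
    exact h.symm.trans h'
  · intro S _
    exact (Set.toFinite _).measurableSet

end Binomial

section GaussianPValue

/-! ### The limit distribution of the resampling p-value -/

/-- The standard Gaussian distribution function. -/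
noncomputable def gaussianCDF (x : ℝ) : ℝ := cdf (gaussianReal 0 1) x

/-- The distribution function of the limit `p`-value `1 - Φ(X)`, where `X` is centred Gaussian with
variance `r` and `Φ` is the standard Gaussian distribution function. -/
noncomputable def limitPValueCDF (r : ℝ≥0) (v : ℝ) : ℝ :=
  (gaussianReal 0 r).real {x | 1 - gaussianCDF x ≤ v}

theorem continuous_gaussianCDF : Continuous gaussianCDF :=
  have := nullSingletonClass_gaussianReal (μ := 0) (v := 1) one_ne_zero
  continuous_cdf _

theorem strictMono_gaussianCDF : StrictMono gaussianCDF := by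
  intro a b hab
  have h1 : 0 < (gaussianReal 0 1) (Set.Ioc a b) := by
    rw [pos_iff_ne_zero]
    intro h
    have := gaussianReal_absolutelyContinuous' 0 (v := 1) one_ne_zero h
    rw [Real.volume_Ioc, ENNReal.ofReal_eq_zero] at this
    linarith
  have h2 : (gaussianReal 0 1) (Set.Ioc a b) = ENNReal.ofReal (gaussianCDF b - gaussianCDF a) := by
    conv_lhs => rw [← measure_cdf (gaussianReal 0 1)]
    exact StieltjesFunction.measure_Ioc _ _ _
  rw [h2, ENNReal.ofReal_pos] at h1
  linarith

theorem gaussianReal_Ici_neg (s : ℝ) : (gaussianReal 0 1).real (Set.Ici (-s)) = gaussianCDF s := by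
  have h : (gaussianReal 0 1).map (fun x => -x) = gaussianReal 0 1 := by
    simpa using gaussianReal_map_neg (μ := 0) (v := 1)
  unfold gaussianCDF
  rw [cdf_eq_real]
  conv_lhs => rw [← h]
  rw [map_measureReal_apply measurable_neg measurableSet_Ici]
  congr 1; ext x; simp

theorem gaussianReal_Ici (s : ℝ) : (gaussianReal 0 1).real (Set.Ici s) = 1 - gaussianCDF s :=
  have := nullSingletonClass_gaussianReal (μ := 0) (v := 1) one_ne_zero
  measureReal_Ici_eq _ s

theorem gaussianCDF_neg (x : ℝ) : gaussianCDF (-x) = 1 - gaussianCDF x := by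
  rw [← gaussianReal_Ici_neg, neg_neg, gaussianReal_Ici]

theorem gaussianCDF_lt_one (x : ℝ) : gaussianCDF x < 1 :=
  (strictMono_gaussianCDF (lt_add_one x)).trans_le (cdf_le_one _ _)

theorem exists_gaussianCDF_eq {v : ℝ} (h0 : 0 < v) (h1 : v < 1) : ∃ s, gaussianCDF s = v := by
  obtain ⟨a, ha⟩ := ((tendsto_cdf_atBot (gaussianReal 0 1)).eventually_lt_const h0).exists
  obtain ⟨b, hb⟩ := ((tendsto_cdf_atTop (gaussianReal 0 1)).eventually_const_lt h1).exists
  exact mem_range_of_exists_le_of_exists_ge continuous_gaussianCDF ⟨a, ha.le⟩ ⟨b, hb.le⟩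

theorem limitPValueCDF_eq (r : ℝ≥0) (s : ℝ) :
    limitPValueCDF r (1 - gaussianCDF s) = (gaussianReal 0 r).real (Set.Ici s) := by
  unfold limitPValueCDF
  congr 1; ext x
  simp only [Set.mem_ofPred_eq, Set.mem_Ici, sub_le_sub_iff_left, strictMono_gaussianCDF.le_iff_le]

theorem limitPValueCDF_one (r : ℝ≥0) : limitPValueCDF r 1 = 1 := by
  have : {x | 1 - gaussianCDF x ≤ 1} = Set.univ := by
    ext x
    have : 0 ≤ gaussianCDF x := cdf_nonneg _ _
    simpa
  rw [limitPValueCDF, this, probReal_univ]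

theorem continuous_limitPValueCDF {r : ℝ≥0} (hr : r ≠ 0) : Continuous (limitPValueCDF r) := by
  have := nullSingletonClass_gaussianReal (μ := 0) hr
  have hm : Measurable fun x => 1 - gaussianCDF x :=
    (continuous_const.sub continuous_gaussianCDF).measurable
  have hp : IsProbabilityMeasure ((gaussianReal 0 r).map fun x => 1 - gaussianCDF x) :=
    Measure.isProbabilityMeasure_map hm.aemeasurable
  have hn : NullSingletonClass ((gaussianReal 0 r).map fun x => 1 - gaussianCDF x) := by
    refine ⟨fun y => ?_⟩
    rw [Measure.map_apply hm (measurableSet_singleton y)]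
    refine Set.Subsingleton.measure_zero (fun a ha b hb => strictMono_gaussianCDF.injective ?_) _
    have h1 : 1 - gaussianCDF a = y := ha
    have h2 : 1 - gaussianCDF b = y := hb
    linarith
  have e : limitPValueCDF r = cdf ((gaussianReal 0 r).map fun x => 1 - gaussianCDF x) := by
    ext v
    rw [cdf_eq_real, map_measureReal_apply hm measurableSet_Iic]
    rfl
  rw [e]
  exact continuous_cdf _

theorem gaussianReal_Ici_le {r : ℝ≥0} (hr : r ≠ 0) (hr1 : r ≤ 1) {s : ℝ} (hs : 0 ≤ s) :
    (gaussianReal 0 r).real (Set.Ici s) ≤ (gaussianReal 0 1).real (Set.Ici s) := by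
  have h : (gaussianReal 0 1).map (fun x => √(r : ℝ) * x) = gaussianReal 0 r := by
    rw [gaussianReal_map_const_mul]
    congr 1
    · simp
    · ext; simp
  rw [← h, map_measureReal_apply (by fun_prop) measurableSet_Ici]
  refine measureReal_mono fun x hx => ?_
  have hx' : s ≤ √(r : ℝ) * x := hx
  have h1 : √(r : ℝ) ≤ 1 := by rw [Real.sqrt_le_one]; exact_mod_cast hr1
  have h0 : 0 < √(r : ℝ) := Real.sqrt_pos.2 (by exact_mod_cast pos_iff_ne_zero.2 hr)
  have hx0 : 0 ≤ x := by
    by_contra hneg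
    have := mul_neg_of_pos_of_neg h0 (not_le.1 hneg)
    linarith
  exact hx'.trans (mul_le_of_le_one_left hx0 h1)

/-- A variance ratio of at most one makes the limit `p`-value stochastically larger than uniform at
levels up to `1 / 2`. -/
theorem limitPValueCDF_le {r : ℝ≥0} (hr : r ≠ 0) (hr1 : r ≤ 1) {v : ℝ} (h0 : 0 ≤ v)
    (h1 : v ≤ 1 / 2) : limitPValueCDF r v ≤ v := by
  rcases h0.eq_or_lt with rfl | h0
  · have : {x | 1 - gaussianCDF x ≤ 0} = ∅ := by
      ext x
      have := gaussianCDF_lt_one x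
      simpa
    rw [limitPValueCDF, this, measureReal_empty]
  · obtain ⟨s, hs⟩ := exists_gaussianCDF_eq (v := 1 - v) (by linarith) (by linarith)
    have hv : v = 1 - gaussianCDF s := by linarith
    have hs0 : 0 ≤ s := by
      by_contra hneg
      have h2 := strictMono_gaussianCDF (show s < -s by linarith)
      rw [gaussianCDF_neg] at h2
      linarith
    rw [hv, limitPValueCDF_eq, ← gaussianReal_Ici]
    exact gaussianReal_Ici_le hr hr1 hs0

/-- The limit `p`-value and its reflection about `1 / 2` have the same continuous distribution. -/
theorem limitPValueCDF_add_le {r : ℝ≥0} (hr : r ≠ 0) (v : ℝ) :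
    limitPValueCDF r v + limitPValueCDF r (1 - v) ≤ 1 := by
  have := nullSingletonClass_gaussianReal (μ := 0) hr
  have hc := continuous_gaussianCDF
  have hneg : (gaussianReal 0 r).map (fun x => -x) = gaussianReal 0 r := by
    simpa using gaussianReal_map_neg (μ := 0) (v := r)
  have hA : MeasurableSet {x | 1 - gaussianCDF x ≤ v} :=
    (isClosed_le (continuous_const.sub hc) continuous_const).measurableSet
  have hB : MeasurableSet {x | 1 - gaussianCDF x ≤ 1 - v} :=
    (isClosed_le (continuous_const.sub hc) continuous_const).measurableSet
  have e1 : limitPValueCDF r (1 - v) = (gaussianReal 0 r).real {x | v ≤ 1 - gaussianCDF x} := by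
    unfold limitPValueCDF
    conv_lhs => rw [← hneg]
    rw [map_measureReal_apply measurable_neg hB]
    congr 1; ext x
    simp [gaussianCDF_neg]
    constructor <;> intro h <;> linarith
  have hC : (gaussianReal 0 r).real {x | v ≤ 1 - gaussianCDF x}
      ≤ (gaussianReal 0 r).real {x | 1 - gaussianCDF x ≤ v}ᶜ := by
    have hsing : (gaussianReal 0 r).real {x | 1 - gaussianCDF x = v} = 0 := by
      rw [measureReal_def, Set.Subsingleton.measure_zero, ENNReal.toReal_zero]
      intro a ha b hb
      have h1 : 1 - gaussianCDF a = v := ha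
      have h2 : 1 - gaussianCDF b = v := hb
      exact strictMono_gaussianCDF.injective (by linarith)
    have hsub : {x | v ≤ 1 - gaussianCDF x}
        ⊆ {x | 1 - gaussianCDF x ≤ v}ᶜ ∪ {x | 1 - gaussianCDF x = v} := by
      intro x hx
      rcases (show v ≤ 1 - gaussianCDF x from hx).lt_or_eq with h | h
      · exact Or.inl (not_le.2 h)
      · exact Or.inr h.symm
    have := (measureReal_mono hsub).trans (measureReal_union_le (μ := gaussianReal 0 r) _ _)
    linarith
  rw [e1]
  have := probReal_compl_eq_one_sub (μ := gaussianReal 0 r) hA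
  unfold limitPValueCDF
  linarith

/-- Pointwise asymptotic upper bounds of monotone functions by a continuous one are uniform. -/
theorem eventually_forall_le_of_monotone {ι : Type*} {l : Filter ι} {G : ι → ℝ → ℝ}
    (hG : ∀ i, Monotone (G i)) {F : ℝ → ℝ} (hF : Continuous F)
    (h : ∀ v, 0 < v → v ≤ 1 → ∀ ε > 0, ∀ᶠ i in l, G i v ≤ F v + ε) {ε : ℝ} (hε : 0 < ε) :
    ∀ᶠ i in l, ∀ v, 0 ≤ v → v ≤ 1 → G i v ≤ F v + ε := by
  have hu := isCompact_Icc.uniformContinuousOn_of_continuous (hF.continuousOn (s := Set.Icc 0 1))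
  obtain ⟨δ, hδ, hu⟩ := Metric.uniformContinuousOn_iff.1 hu (ε / 2) (by positivity)
  obtain ⟨K, hK⟩ := exists_nat_one_div_lt hδ
  -- A grid of mesh `1 / (K + 1) < δ` in `(0, 1]`; each `v` is compared with the next grid point.
  set w : ℕ → ℝ := fun i => min (((i : ℝ) + 1) / (K + 1)) 1 with hw
  have hK0 : (0 : ℝ) < K + 1 := by positivity
  have hev : ∀ᶠ i in l, ∀ n ∈ Finset.range (K + 2), G i (w n) ≤ F (w n) + ε / 2 := by
    rw [eventually_all_finset]
    intro n _
    exact h (w n) (lt_min (by positivity) one_pos) (min_le_right _ _) (ε / 2) (by positivity)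
  filter_upwards [hev] with i hi v hv0 hv1
  set n := ⌊v * (K + 1)⌋₊ with hn
  have hn1 : (n : ℝ) ≤ v * (K + 1) := Nat.floor_le (by positivity)
  have hn2 : v * (K + 1) < n + 1 := Nat.lt_floor_add_one _
  have hnK : n ∈ Finset.range (K + 2) := by
    have : (n : ℝ) ≤ K + 1 := hn1.trans (mul_le_of_le_one_left hK0.le hv1)
    have : n ≤ K + 1 := by exact_mod_cast this
    exact Finset.mem_range.2 (by omega)
  have hvw : v ≤ w n := le_min ((le_div_iff₀ hK0).2 hn2.le) hv1
  have hwv : w n - v < δ := by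
    refine lt_of_le_of_lt ?_ hK
    have h1 : w n ≤ ((n : ℝ) + 1) / (K + 1) := min_le_left _ _
    have h2 : ((n : ℝ) + 1) / (K + 1) ≤ v + 1 / (K + 1) := by
      rw [add_div]
      gcongr
      exact (div_le_iff₀ hK0).2 hn1
    linarith
  have hd := hu (w n) ⟨hv0.trans hvw, min_le_right _ _⟩ v ⟨hv0, hv1⟩ (by
    rw [Real.dist_eq, abs_of_nonneg (by linarith)]; exact hwv)
  rw [Real.dist_eq] at hd
  have := hG i hvw
  have := hi n hnK
  linarith [(abs_lt.1 hd).2]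

end GaussianPValue

section HorvitzThompson

/-! ### Moments of the Horvitz–Thompson summands -/

/-- A summand of the Horvitz–Thompson estimator (times the number of sessions), as a function of
the label: `a` is the outcome under treatment, which has probability `p`, and `b` the one under
control. -/
noncomputable def htTerm (p a b : ℝ) (z : Bool) : ℝ :=
  if z = true then a / p else -(b / (1 - p))

theorem tStud_eq_selfNormalized {J : ℕ} (p y : Fin J → ℝ) (z : Fin J → Bool) :
    tStud p y z = selfNormalized (fun j => htTerm (p j) (y j) (y j)) z := by
  have hV : varUp p y z = (∑ j, htTerm (p j) (y j) (y j) (z j) ^ 2) / (J : ℝ) ^ 2 := by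
    unfold varUp
    congr 1
    refine Finset.sum_congr rfl fun j _ => ?_
    unfold htTerm
    split_ifs
    · rw [div_pow, mul_one_div]
    · rw [neg_sq, div_pow, mul_one_div]
  unfold tStud selfNormalized
  rw [hV, Real.sqrt_div (Finset.sum_nonneg fun j _ => sq_nonneg _), Real.sqrt_sq (Nat.cast_nonneg J)]
  unfold tauHT
  rcases Nat.eq_zero_or_pos J with rfl | hJ
  · simp
  · have : (J : ℝ) ≠ 0 := by positivity
    exact div_div_div_cancel_right₀ this _ _

theorem htTerm_neg (p a b : ℝ) (z : Bool) : htTerm p (-a) (-b) z = -htTerm p a b z := by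
  unfold htTerm
  split_ifs <;> ring

variable {p : ℝ} (hp : p ∈ Set.Ioo (0 : ℝ) 1) (a b : ℝ)

theorem integral_htTerm :
    ∫ z, htTerm p a b z ∂(bernoulliMeasure true false ⟨p, hp.1.le, hp.2.le⟩) = a - b := by
  have h1 := hp.1.ne'
  have h2 := (sub_pos.2 hp.2).ne'
  rw [integral_bernoulliMeasure]
  simp [htTerm]
  field_simp
  ring

theorem integral_htTerm_sq :
    ∫ z, htTerm p a b z ^ 2 ∂(bernoulliMeasure true false ⟨p, hp.1.le, hp.2.le⟩)
      = a ^ 2 / p + b ^ 2 / (1 - p) := by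
  have h1 := hp.1.ne'
  have h2 := (sub_pos.2 hp.2).ne'
  rw [integral_bernoulliMeasure]
  simp [htTerm]
  field_simp

theorem integral_htTerm_pow_four :
    ∫ z, htTerm p a b z ^ 4 ∂(bernoulliMeasure true false ⟨p, hp.1.le, hp.2.le⟩)
      = a ^ 4 / p ^ 3 + b ^ 4 / (1 - p) ^ 3 := by
  have h1 := hp.1.ne'
  have h2 := (sub_pos.2 hp.2).ne'
  rw [integral_bernoulliMeasure]
  simp [htTerm]
  field_simp

theorem variance_htTerm :
    Var[htTerm p a b; bernoulliMeasure true false ⟨p, hp.1.le, hp.2.le⟩]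
      = (√((1 - p) / p) * a + √(p / (1 - p)) * b) ^ 2 := by
  have h1 := hp.1
  have h2 := sub_pos.2 hp.2
  rw [variance_eq_sub (memLp_of_fintype _ _ 2), integral_htTerm hp]
  have := integral_htTerm_sq hp a b
  simp only [Pi.pow_apply]
  rw [this]
  have e1 : √((1 - p) / p) ^ 2 = (1 - p) / p := Real.sq_sqrt (by positivity)
  have e2 : √(p / (1 - p)) ^ 2 = p / (1 - p) := Real.sq_sqrt (by positivity)
  have e3 : √((1 - p) / p) * √(p / (1 - p)) = 1 := by
    rw [← Real.sqrt_mul (by positivity)]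
    have : (1 - p) / p * (p / (1 - p)) = 1 := by field_simp
    rw [this, Real.sqrt_one]
  have e4 : (√((1 - p) / p) * a + √(p / (1 - p)) * b) ^ 2
      = √((1 - p) / p) ^ 2 * a ^ 2 + √(p / (1 - p)) ^ 2 * b ^ 2
        + 2 * (√((1 - p) / p) * √(p / (1 - p))) * (a * b) := by ring
  rw [e4, e1, e2, e3]
  field_simp
  ring

end HorvitzThompson

section Design

/-! ### Observed session means -/

variable {L m J : ℕ}

theorem RegularSwitchback.switch_eq (D : RegularSwitchback (J * L) J) (hD : D.EqualLength L)
    (k : Fin (J + 1)) : D.switch k = k * L := by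
  induction k using Fin.induction with
  | zero => simp [D.switch_zero]
  | succ i ih =>
    rw [hD i, ih]
    simp
    ring

/-- Discarding the first `m` periods of a session removes the dependence on earlier sessions: the
observed focal mean is the potential one under the session's own label. -/
theorem observedMean_path (D : RegularSwitchback (J * L) J) (hD : D.EqualLength L)
    (Y : PotentialOutcomes (J * L)) (hna : NonAnticipating Y) (hco : CarryoverAtMost m Y)
    (z : Fin J → Bool) (j : Fin J) :
    observedMean L m Y (D.path z) j = focalMean L m Y j (z j) := by
  unfold observedMean focalMean focalOutcome
  congr 1
  refine Finset.sum_congr rfl fun l _ => ?_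
  set t := focalTime L m j l with ht
  have htv : (t : ℕ) = j * L + m + l := rfl
  have hl : m + (l : ℕ) < L := by have := l.isLt; omega
  rw [hna t (D.path z) (fun s => if s ≤ t then D.path z s else z j)
    fun s hs => by simp [hs]]
  refine hco t _ _ (by omega) fun s hs => ?_
  split_ifs with hst
  · refine D.path_eq z ⟨?_, ?_⟩
    · rw [D.switch_eq hD]
      simp only [Fin.val_castSucc]
      omega
    · rw [D.switch_eq hD]
      have : (s : ℕ) ≤ t := hst
      simp only [Fin.val_succ, add_mul, one_mul]
      omega
  · rfl

/-- The focal-average effect is the mean of the effects at the focal positions. -/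
theorem focalAverageEffect_eq_zero (Y : PotentialOutcomes (J * L))
    (h : ∀ l, positionEffect L m Y l = 0) : focalAverageEffect L m Y = 0 := by
  unfold focalAverageEffect focalMean
  rcases Nat.eq_zero_or_pos J with rfl | hJ
  · simp
  have hJ' : (J : ℝ) ≠ 0 := by positivity
  have h' : ∀ l, ∑ j, (focalOutcome L m Y j l true - focalOutcome L m Y j l false) = 0 := by
    intro l
    have := h l
    unfold positionEffect at this
    exact (div_eq_zero_iff.1 this).resolve_right hJ'
  simp only [← sub_div, ← Finset.sum_sub_distrib, ← Finset.sum_div]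
  rw [Finset.sum_comm]
  simp [h']

end Design

section Rejection

/-! ### The rejection probability as a binomial mixture -/

/-- The law of a single session label. -/
noncomputable abbrev RegularSwitchback.sessionLaw {T N : ℕ} (D : RegularSwitchback T N)
    (k : Fin N) : Measure Bool :=
  bernoulliMeasure true false ⟨D.q k, (D.q_mem k).1.le, (D.q_mem k).2.le⟩

/-- The exact `p`-value of the resampling distribution, which the Monte Carlo `p`-value
approximates. -/
noncomputable def resamplingPValue (L m : ℕ) {J : ℕ} (D : RegularSwitchback (J * L) J)
    (Y : PotentialOutcomes (J * L)) (z : Fin J → Bool) : ℝ :=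
  D.labelLaw.real {z' | tStud D.q (observedMean L m Y (D.path z)) z
    ≤ tStud D.q (observedMean L m Y (D.path z)) z'}

theorem RegularSwitchback.isProbabilityMeasure_labelLaw {T N : ℕ} (D : RegularSwitchback T N) :
    IsProbabilityMeasure D.labelLaw := by
  unfold RegularSwitchback.labelLaw
  infer_instance

attribute [instance] RegularSwitchback.isProbabilityMeasure_labelLaw

/-- Given the realized labels, the number of resamples at least as extreme is binomial. -/
theorem rejectionProb_eq (L m : ℕ) {J : ℕ} (D : RegularSwitchback (J * L) J)
    (Y : PotentialOutcomes (J * L)) (M : ℕ) {α : ℝ} (hα : 0 ≤ α) :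
    rejectionProb L m D Y M α = ENNReal.ofReal
      (∫ z, binomialTail M ⌊α * (M + 1)⌋₊ (resamplingPValue L m D Y z) ∂D.labelLaw) := by
  unfold rejectionProb jointLaw
  rw [Measure.prod_apply (Set.toFinite _).measurableSet]
  have h : ∀ z, (Measure.pi fun _ : Fin M => D.labelLaw)
      (Prod.mk z ⁻¹' {x | crtPValue L m D Y x.1 x.2 ≤ α})
      = ENNReal.ofReal (binomialTail M ⌊α * (M + 1)⌋₊ (resamplingPValue L m D Y z)) := by
    intro z
    unfold resamplingPValue
    rw [← pi_measureReal_card_lt D.labelLaw (fun z' => tStud D.q (observedMean L m Y (D.path z)) z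
      ≤ tStud D.q (observedMean L m Y (D.path z)) z') M, ofReal_measureReal]
    congr 1
    ext zs
    have hM : (0 : ℝ) < M + 1 := by positivity
    simp only [Set.mem_preimage, Set.mem_ofPred_eq, crtPValue, monteCarloPValue]
    rw [div_le_iff₀ hM, ← Nat.succ_le_iff, Nat.le_floor_iff (by positivity)]
    push_cast
    rfl
  simp only [h]
  rw [ofReal_integral_eq_lintegral_ofReal Integrable.of_finite]
  refine Eventually.of_forall fun z => ?_
  simp only [Pi.zero_apply]
  unfold resamplingPValue
  rw [← pi_measureReal_card_lt D.labelLaw (fun z' => tStud D.q (observedMean L m Y (D.path z)) z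
      ≤ tStud D.q (observedMean L m Y (D.path z)) z') M]
  exact measureReal_nonneg

end Rejection

section Asymptotics

/-! ### Resampled statistics and limiting moments -/

theorem mem_Ioo_of_mem_Icc {pmin p : ℝ} (hpmin : pmin ∈ Set.Ioo (0 : ℝ) (1 / 2))
    (hp : p ∈ Set.Icc pmin (1 - pmin)) : p ∈ Set.Ioo (0 : ℝ) 1 :=
  ⟨hpmin.1.trans_le hp.1, by linarith [hp.2, hpmin.1]⟩

theorem integral_htTerm_pow_four_le {pmin p : ℝ} (hpmin : pmin ∈ Set.Ioo (0 : ℝ) (1 / 2))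
    (hp : p ∈ Set.Icc pmin (1 - pmin)) (hp' : p ∈ Set.Ioo (0 : ℝ) 1) (a b : ℝ) :
    ∫ z, htTerm p a b z ^ 4 ∂(bernoulliMeasure true false ⟨p, hp'.1.le, hp'.2.le⟩)
      ≤ (a ^ 4 + b ^ 4) / pmin ^ 3 := by
  have h0 := hpmin.1
  have h1 : pmin ≤ 1 - p := by linarith [hp.2]
  rw [integral_htTerm_pow_four hp', add_div]
  gcongr
  exact hp.1

/-- The conditional central limit theorem for the resampled statistic, uniformly over observed
session means with second moment bounded below and fourth moment bounded above. The summands being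
centred, studentization yields a standard Gaussian limit. -/
theorem eventually_forall_resampled_tail_le {T : ℕ → ℕ} (D : ∀ J, RegularSwitchback (T J) J)
    {pmin : ℝ} (hpmin : pmin ∈ Set.Ioo (0 : ℝ) (1 / 2))
    (hp : ∀ J j, (D J).q j ∈ Set.Icc pmin (1 - pmin)) {c C : ℝ} (hc : 0 < c) (s : ℝ) {ε : ℝ}
    (hε : 0 < ε) :
    ∀ᶠ J in atTop, ∀ y : Fin J → ℝ, c * J ≤ ∑ j, y j ^ 2 → ∑ j, y j ^ 4 ≤ C * J →
      (D J).labelLaw.real {z | s ≤ selfNormalized (fun j => htTerm ((D J).q j) (y j) (y j)) z}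
        ≤ (gaussianReal 0 1).real (Set.Ici s) + ε := by
  have h0 := hpmin.1
  -- Uniformity in `y` comes from running the central limit theorem along a filter on all pairs
  -- `(J, y)` that only sends `J` to infinity.
  let l : Filter (Σ J : ℕ, Fin J → ℝ) := comap Sigma.fst atTop ⊓
    𝓟 {i | c * i.1 ≤ ∑ j, i.2 j ^ 2 ∧ ∑ j, i.2 j ^ 4 ≤ C * i.1}
  have hgood : ∀ᶠ i in l, c * i.1 ≤ ∑ j, i.2 j ^ 2 ∧ ∑ j, i.2 j ^ 4 ≤ C * i.1 :=
    mem_inf_of_right (mem_principal_self _)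
  have hN : Tendsto (fun i : Σ J : ℕ, Fin J → ℝ => i.1) l atTop := tendsto_comap.mono_left inf_le_left
  have hsq : ∀ (i : Σ J : ℕ, Fin J → ℝ) (j : Fin i.1), i.2 j ^ 2
      ≤ ∫ z, htTerm ((D i.1).q j) (i.2 j) (i.2 j) z ^ 2 ∂((D i.1).sessionLaw j) := by
    intro i j
    have hq := (D i.1).q_mem j
    rw [integral_htTerm_sq hq]
    have h1 : i.2 j ^ 2 ≤ i.2 j ^ 2 / (D i.1).q j :=
      le_div_self (sq_nonneg _) hq.1 hq.2.le
    have h2 : 0 ≤ i.2 j ^ 2 / (1 - (D i.1).q j) :=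
      div_nonneg (sq_nonneg _) (by linarith [hq.2])
    linarith
  have hmain := eventually_selfNormalized_tail_le (l := l) (fun i => i.1) hN
    (fun i k => (D i.1).sessionLaw k)
    (fun i j => htTerm ((D i.1).q j) (i.2 j) (i.2 j)) (c := c) (C := 2 * C / pmin ^ 3) hc
    (r := 1) one_ne_zero ?_ ?_ ?_ ?_ s hε
  · rw [eventually_inf_principal, eventually_comap] at hmain
    filter_upwards [hmain] with J hJ y hy2 hy4
    exact hJ ⟨J, y⟩ rfl ⟨hy2, hy4⟩
  · refine Eventually.of_forall fun i => Finset.sum_eq_zero fun j _ => ?_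
    rw [integral_htTerm ((D i.1).q_mem j), sub_self]
  · filter_upwards [hgood] with i hi
    calc _ ≤ ∑ j, (i.2 j ^ 4 + i.2 j ^ 4) / pmin ^ 3 := Finset.sum_le_sum fun j _ =>
          integral_htTerm_pow_four_le hpmin (hp i.1 j) ((D i.1).q_mem j) _ _
      _ = 2 / pmin ^ 3 * ∑ j, i.2 j ^ 4 := by
          rw [Finset.mul_sum]
          exact Finset.sum_congr rfl fun j _ => by ring
      _ ≤ 2 / pmin ^ 3 * (C * i.1) := by gcongr; exact hi.2
      _ = _ := by ring
  · filter_upwards [hgood] with i hi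
    exact hi.1.trans (Finset.sum_le_sum fun j _ => hsq i j)
  · refine tendsto_const_nhds.congr' ?_
    filter_upwards [hgood, hN.eventually_gt_atTop 0] with i hi hi0
    have hi0' : (0 : ℝ) < i.1 := by exact_mod_cast hi0
    have hpos : 0 < ∑ j, ∫ z, htTerm ((D i.1).q j) (i.2 j) (i.2 j) z ^ 2 ∂((D i.1).sessionLaw j) :=
      lt_of_lt_of_le (by positivity) (hi.1.trans (Finset.sum_le_sum fun j _ => hsq i j))
    have hv : ∀ j, Var[htTerm ((D i.1).q j) (i.2 j) (i.2 j); (D i.1).sessionLaw j]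
        = ∫ z, htTerm ((D i.1).q j) (i.2 j) (i.2 j) z ^ 2 ∂((D i.1).sessionLaw j) := fun j => by
      rw [variance_eq_sub (memLp_of_fintype _ _ 2), integral_htTerm ((D i.1).q_mem j), sub_self]
      simp
    simp only [hv]
    rw [div_self hpos.ne', NNReal.coe_one]

theorem selfNormalized_htTerm_neg {J : ℕ} (p y : Fin J → ℝ) (z : Fin J → Bool) :
    selfNormalized (fun j => htTerm (p j) (-y j) (-y j)) z
      = -selfNormalized (fun j => htTerm (p j) (y j) (y j)) z := by
  simp only [selfNormalized, htTerm_neg, Finset.sum_neg_distrib, neg_sq, neg_div]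

/-- The projection of `p` to `[pmin, 1 - pmin]`, used to turn functions of the assignment
probability into continuous functions on the whole line. -/
noncomputable def clampProb (pmin p : ℝ) : ℝ := max pmin (min p (1 - pmin))

theorem continuous_clampProb (pmin : ℝ) : Continuous (clampProb pmin) :=
  continuous_const.max (continuous_id.min continuous_const)

theorem clampProb_mem {pmin : ℝ} (hpmin : pmin ∈ Set.Ioo (0 : ℝ) (1 / 2)) (p : ℝ) :
    clampProb pmin p ∈ Set.Icc pmin (1 - pmin) :=
  ⟨le_max_left _ _, max_le (by linarith [hpmin.2]) (min_le_right _ _)⟩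

theorem clampProb_eq {pmin p : ℝ} (hp : p ∈ Set.Icc pmin (1 - pmin)) : clampProb pmin p = p := by
  unfold clampProb
  rw [min_eq_left hp.2, max_eq_right hp.1]

/-- Sampling variance of a summand of the Horvitz–Thompson estimator. -/
noncomputable def samplingVar (pmin : ℝ) (x : ℝ × ℝ × ℝ) : ℝ :=
  (√((1 - clampProb pmin x.1) / clampProb pmin x.1) * x.2.1
    + √(clampProb pmin x.1 / (1 - clampProb pmin x.1)) * x.2.2) ^ 2

/-- Second moment of a summand of the Horvitz–Thompson estimator, the mean of its contribution to
the variance estimator. -/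
noncomputable def secondMoment (pmin : ℝ) (x : ℝ × ℝ × ℝ) : ℝ :=
  x.2.1 ^ 2 / clampProb pmin x.1 + x.2.2 ^ 2 / (1 - clampProb pmin x.1)

theorem continuous_samplingVar {pmin : ℝ} (hpmin : pmin ∈ Set.Ioo (0 : ℝ) (1 / 2)) :
    Continuous (samplingVar pmin) := by
  have hP : Continuous fun x : ℝ × ℝ × ℝ => clampProb pmin x.1 :=
    (continuous_clampProb pmin).comp continuous_fst
  have h1 : ∀ x : ℝ × ℝ × ℝ, clampProb pmin x.1 ≠ 0 := fun x =>
    (mem_Ioo_of_mem_Icc hpmin (clampProb_mem hpmin x.1)).1.ne'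
  have h2 : ∀ x : ℝ × ℝ × ℝ, 1 - clampProb pmin x.1 ≠ 0 := fun x =>
    (sub_pos.2 (mem_Ioo_of_mem_Icc hpmin (clampProb_mem hpmin x.1)).2).ne'
  exact ((((continuous_const.sub hP).div hP h1).sqrt.mul (by fun_prop)).add
    ((hP.div (continuous_const.sub hP) h2).sqrt.mul (by fun_prop))).pow 2

theorem continuous_secondMoment {pmin : ℝ} (hpmin : pmin ∈ Set.Ioo (0 : ℝ) (1 / 2)) :
    Continuous (secondMoment pmin) := by
  have hP : Continuous fun x : ℝ × ℝ × ℝ => clampProb pmin x.1 :=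
    (continuous_clampProb pmin).comp continuous_fst
  have h1 : ∀ x : ℝ × ℝ × ℝ, clampProb pmin x.1 ≠ 0 := fun x =>
    (mem_Ioo_of_mem_Icc hpmin (clampProb_mem hpmin x.1)).1.ne'
  have h2 : ∀ x : ℝ × ℝ × ℝ, 1 - clampProb pmin x.1 ≠ 0 := fun x =>
    (sub_pos.2 (mem_Ioo_of_mem_Icc hpmin (clampProb_mem hpmin x.1)).2).ne'
  exact (Continuous.div (by fun_prop) hP h1).add
    (Continuous.div (by fun_prop) (continuous_const.sub hP) h2)

theorem samplingVar_le_secondMoment {pmin : ℝ} (hpmin : pmin ∈ Set.Ioo (0 : ℝ) (1 / 2))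
    (x : ℝ × ℝ × ℝ) : samplingVar pmin x ≤ secondMoment pmin x := by
  have hp := mem_Ioo_of_mem_Icc hpmin (clampProb_mem hpmin x.1)
  unfold samplingVar secondMoment
  rw [← variance_htTerm hp, ← integral_htTerm_sq hp, variance_eq_sub (memLp_of_fintype _ _ 2)]
  simpa using sq_nonneg _

theorem secondMoment_nonneg {pmin : ℝ} (hpmin : pmin ∈ Set.Ioo (0 : ℝ) (1 / 2))
    (x : ℝ × ℝ × ℝ) : 0 ≤ secondMoment pmin x :=
  (sq_nonneg _).trans (samplingVar_le_secondMoment hpmin x)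

theorem secondMoment_le {pmin : ℝ} (hpmin : pmin ∈ Set.Ioo (0 : ℝ) (1 / 2)) (x : ℝ × ℝ × ℝ) :
    secondMoment pmin x ≤ (x.2.1 ^ 2 + x.2.2 ^ 2) / pmin := by
  have h0 := hpmin.1
  have hp := clampProb_mem hpmin x.1
  unfold secondMoment
  rw [add_div]
  gcongr
  · exact hp.1
  · linarith [hp.2]

theorem secondMoment_sq_le {pmin : ℝ} (hpmin : pmin ∈ Set.Ioo (0 : ℝ) (1 / 2)) (x : ℝ × ℝ × ℝ) :
    secondMoment pmin x ^ 2 ≤ 4 / pmin ^ 2 * (max |x.2.1| |x.2.2|) ^ 4 := by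
  have h0 := hpmin.1
  have h1 : x.2.1 ^ 2 ≤ (max |x.2.1| |x.2.2|) ^ 2 := by
    rw [← sq_abs]; gcongr; exact le_max_left _ _
  have h2 : x.2.2 ^ 2 ≤ (max |x.2.1| |x.2.2|) ^ 2 := by
    rw [← sq_abs]; gcongr; exact le_max_right _ _
  calc secondMoment pmin x ^ 2 ≤ ((x.2.1 ^ 2 + x.2.2 ^ 2) / pmin) ^ 2 :=
        pow_le_pow_left₀ (secondMoment_nonneg hpmin x) (secondMoment_le hpmin x) 2
    _ ≤ (((max |x.2.1| |x.2.2|) ^ 2 + (max |x.2.1| |x.2.2|) ^ 2) / pmin) ^ 2 := by gcongr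
    _ = _ := by ring

/-- The limit of the average sampling variances is the asymptotic sampling variance. -/
theorem integral_samplingVar {pmin : ℝ} (ν : ProbabilityMeasure (ℝ × ℝ × ℝ))
    (hν : ν (Set.Icc pmin (1 - pmin) ×ˢ Set.univ) = 1) :
    ∫ x, samplingVar pmin x ∂(ν : Measure (ℝ × ℝ × ℝ)) = sigmaSqS ν := by
  unfold sigmaSqS
  have hm : MeasurableSet (Set.Icc pmin (1 - pmin) ×ˢ (Set.univ : Set (ℝ × ℝ))) :=
    measurableSet_Icc.prod MeasurableSet.univ
  have hae : ∀ᵐ x ∂(ν : Measure (ℝ × ℝ × ℝ)),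
      x ∈ Set.Icc pmin (1 - pmin) ×ˢ (Set.univ : Set (ℝ × ℝ)) := by
    have h1 : (ν : Measure (ℝ × ℝ × ℝ)) (Set.Icc pmin (1 - pmin) ×ˢ Set.univ) = 1 := by
      rw [← ProbabilityMeasure.ennreal_coeFn_eq_coeFn_toMeasure, hν, ENNReal.coe_one]
    exact (mem_ae_iff_prob_eq_one hm).2 h1
  refine integral_congr_ae ?_
  filter_upwards [hae] with x hx
  simp only [samplingVar, clampProb_eq hx.1]

end Asymptotics

section MainAsymptotics

/-! ### Asymptotics under the weak null hypothesis -/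

/-- The point `(p_j, Ȳ_j(1), Ȳ_j(0))` of session `j`. -/
noncomputable def sessionTriple (L m : ℕ) {J : ℕ} (D : RegularSwitchback (J * L) J)
    (Y : PotentialOutcomes (J * L)) (j : Fin J) : ℝ × ℝ × ℝ :=
  (D.q j, focalMean L m Y j true, focalMean L m Y j false)

/-- The summand of the Horvitz–Thompson estimator (times the number of sessions) contributed by
session `j`, as a function of its label. -/
noncomputable def observedTerm (L m : ℕ) {J : ℕ} (D : RegularSwitchback (J * L) J)
    (Y : PotentialOutcomes (J * L)) (j : Fin J) : Bool → ℝ :=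
  htTerm (D.q j) (focalMean L m Y j true) (focalMean L m Y j false)

theorem tStud_observedMean {L m J : ℕ} (D : RegularSwitchback (J * L) J) (hD : D.EqualLength L)
    (Y : PotentialOutcomes (J * L)) (hna : NonAnticipating Y) (hco : CarryoverAtMost m Y)
    (z : Fin J → Bool) :
    tStud D.q (observedMean L m Y (D.path z)) z = selfNormalized (observedTerm L m D Y) z := by
  have h : ∀ j, htTerm (D.q j) (observedMean L m Y (D.path z) j)
      (observedMean L m Y (D.path z) j) (z j) = observedTerm L m D Y j (z j) := by
    intro j
    rw [observedMean_path D hD Y hna hco z j]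
    unfold observedTerm htTerm
    cases z j <;> simp
  rw [tStud_eq_selfNormalized]
  simp only [selfNormalized, h]

variable {L m : ℕ} (D : ∀ J : ℕ, RegularSwitchback (J * L) J)
  (Y : ∀ J : ℕ, PotentialOutcomes (J * L)) {pmin : ℝ} (hpmin : pmin ∈ Set.Ioo (0 : ℝ) (1 / 2))
  (hp : ∀ J j, (D J).q j ∈ Set.Icc pmin (1 - pmin)) {C : ℝ}
  (hC : ∀ J : ℕ, 1 ≤ J → (∑ j, (max |focalMean L m (Y J) j true|
    |focalMean L m (Y J) j false|) ^ 4) / (J : ℝ) ≤ C)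

include hC in
theorem sum_max_pow_four_le (J : ℕ) :
    ∑ j, (max |focalMean L m (Y J) j true| |focalMean L m (Y J) j false|) ^ 4 ≤ C * J := by
  rcases Nat.eq_zero_or_pos J with rfl | hJ
  · simp
  · have hJ' : (0 : ℝ) < J := by exact_mod_cast hJ
    exact (div_le_iff₀ hJ').1 (hC J hJ)

theorem pow_four_le_max (a b : ℝ) : a ^ 4 ≤ (max |a| |b|) ^ 4 ∧ b ^ 4 ≤ (max |a| |b|) ^ 4 := by
  have h : ∀ x : ℝ, x ^ 4 = |x| ^ 4 := fun x => by rw [← abs_pow, abs_of_nonneg (by positivity)]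
  rw [h a, h b]
  exact ⟨by gcongr; exact le_max_left _ _, by gcongr; exact le_max_right _ _⟩

include hp in
theorem integral_observedTerm_sq (J : ℕ) (j : Fin J) :
    ∫ z, observedTerm L m (D J) (Y J) j z ^ 2 ∂((D J).sessionLaw j)
      = secondMoment pmin (sessionTriple L m (D J) (Y J) j) := by
  unfold observedTerm secondMoment sessionTriple
  rw [integral_htTerm_sq ((D J).q_mem j)]
  simp only [clampProb_eq (hp J j)]

include hp in
theorem variance_observedTerm (J : ℕ) (j : Fin J) :
    Var[observedTerm L m (D J) (Y J) j; (D J).sessionLaw j]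
      = samplingVar pmin (sessionTriple L m (D J) (Y J) j) := by
  unfold observedTerm samplingVar sessionTriple
  rw [variance_htTerm ((D J).q_mem j)]
  simp only [clampProb_eq (hp J j)]

include hpmin hC in
theorem sum_secondMoment_sq_le (J : ℕ) :
    ∑ j, secondMoment pmin (sessionTriple L m (D J) (Y J) j) ^ 2 ≤ 4 / pmin ^ 2 * C * J := by
  have h : ∀ j, secondMoment pmin (sessionTriple L m (D J) (Y J) j) ^ 2
      ≤ 4 / pmin ^ 2 * (max |focalMean L m (Y J) j true| |focalMean L m (Y J) j false|) ^ 4 :=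
    fun j => secondMoment_sq_le hpmin (sessionTriple L m (D J) (Y J) j)
  refine (Finset.sum_le_sum fun j _ => h j).trans ?_
  rw [← Finset.mul_sum, mul_assoc]
  exact mul_le_mul_of_nonneg_left (sum_max_pow_four_le Y hC J) (by positivity)

variable (ν : ProbabilityMeasure (ℝ × ℝ × ℝ))
  (hν : ν (Set.Icc pmin (1 - pmin) ×ˢ Set.univ) = 1)
  (hconv : Tendsto (fun J => empiricalLaw L m (D J) (Y J)) atTop (𝓝 ν.toFiniteMeasure))
  (hpos : 0 < sigmaSqS ν)

include hpmin hC hν hconv in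
theorem tendsto_average_samplingVar :
    Tendsto (fun J : ℕ => (∑ j, samplingVar pmin (sessionTriple L m (D J) (Y J) j)) / (J : ℝ))
      atTop (𝓝 (sigmaSqS ν)) := by
  rw [← integral_samplingVar ν hν]
  refine tendsto_average (fun J j => sessionTriple L m (D J) (Y J) j) ν hconv _
    (continuous_samplingVar hpmin) (fun x => sq_nonneg _) (C := 4 / pmin ^ 2 * C)
    (Eventually.of_forall fun J => ?_)
  refine (Finset.sum_le_sum fun j _ => ?_).trans (sum_secondMoment_sq_le D Y hpmin hC J)
  exact pow_le_pow_left₀ (sq_nonneg _) (samplingVar_le_secondMoment hpmin _) 2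

include hpmin hC hconv in
theorem tendsto_average_secondMoment :
    Tendsto (fun J : ℕ => (∑ j, secondMoment pmin (sessionTriple L m (D J) (Y J) j)) / (J : ℝ))
      atTop (𝓝 (∫ x, secondMoment pmin x ∂(ν : Measure (ℝ × ℝ × ℝ)))) := by
  refine tendsto_average (fun J j => sessionTriple L m (D J) (Y J) j) ν hconv _
    (continuous_secondMoment hpmin) (secondMoment_nonneg hpmin) (C := 4 / pmin ^ 2 * C)
    (Eventually.of_forall (sum_secondMoment_sq_le D Y hpmin hC))

include hpmin hC hν hconv hpos in
theorem eventually_le_sum_secondMoment :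
    ∀ᶠ J : ℕ in atTop, sigmaSqS ν / 2 * J
      ≤ ∑ j, secondMoment pmin (sessionTriple L m (D J) (Y J) j) := by
  have h := tendsto_average_samplingVar D Y hpmin hC ν hν hconv
  filter_upwards [h.eventually_const_lt (show sigmaSqS ν / 2 < sigmaSqS ν by linarith),
    eventually_gt_atTop 0] with J hJ hJ0
  have hJ' : (0 : ℝ) < J := by exact_mod_cast hJ0
  rw [lt_div_iff₀ hJ'] at hJ
  exact hJ.le.trans (Finset.sum_le_sum fun j _ => samplingVar_le_secondMoment hpmin _)

include hpmin hp hC hν hconv hpos in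
/-- Under the weak null hypothesis the studentized statistic is asymptotically centred Gaussian
with variance at most `1`: the variance estimator is conservative. -/
theorem exists_observed_tail_le (hnull : ∀ J, focalAverageEffect L m (Y J) = 0) :
    ∃ r : ℝ≥0, r ≠ 0 ∧ r ≤ 1 ∧ ∀ s : ℝ, ∀ ε > 0, ∀ᶠ J in atTop,
      (D J).labelLaw.real {z | s ≤ selfNormalized (observedTerm L m (D J) (Y J)) z}
        ≤ (gaussianReal 0 r).real (Set.Ici s) + ε := by
  have h0 := hpmin.1
  have hS := tendsto_average_samplingVar D Y hpmin hC ν hν hconv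
  have hQ := tendsto_average_secondMoment D Y hpmin hC ν hconv
  set τ := ∫ x, secondMoment pmin x ∂(ν : Measure (ℝ × ℝ × ℝ)) with hτ
  have hle : sigmaSqS ν ≤ τ := le_of_tendsto_of_tendsto' hS hQ fun J => by
    gcongr
    exact samplingVar_le_secondMoment hpmin _
  have hτ0 : 0 < τ := hpos.trans_le hle
  have hr0 : 0 < sigmaSqS ν / τ := by positivity
  refine ⟨⟨sigmaSqS ν / τ, hr0.le⟩, ?_, ?_, fun s ε hε => ?_⟩
  · exact fun h => hr0.ne' (congrArg NNReal.toReal h)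
  · exact (div_le_one hτ0).2 hle
  refine eventually_selfNormalized_tail_le (fun J => J) tendsto_id
    (fun J j => (D J).sessionLaw j) (fun J => observedTerm L m (D J) (Y J))
    (c := sigmaSqS ν / 2) (C := 2 * C / pmin ^ 3) (by positivity) ?_ ?_ ?_ ?_ ?_ s hε
  · exact fun h => hr0.ne' (congrArg NNReal.toReal h)
  · filter_upwards [eventually_gt_atTop 0] with J hJ0
    have hJ' : (J : ℝ) ≠ 0 := by positivity
    have h1 : ∀ j, ∫ z, observedTerm L m (D J) (Y J) j z ∂((D J).sessionLaw j)
        = focalMean L m (Y J) j true - focalMean L m (Y J) j false := fun j =>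
      integral_htTerm ((D J).q_mem j) _ _
    simp only [h1]
    exact (div_eq_zero_iff.1 (hnull J)).resolve_right hJ'
  · refine Eventually.of_forall fun J => ?_
    calc _ ≤ ∑ j, 2 / pmin ^ 3 * (max |focalMean L m (Y J) j true|
          |focalMean L m (Y J) j false|) ^ 4 := Finset.sum_le_sum fun j _ => by
          refine (integral_htTerm_pow_four_le hpmin (hp J j) ((D J).q_mem j) _ _).trans ?_
          obtain ⟨h1, h2⟩ := pow_four_le_max (focalMean L m (Y J) j true)
            (focalMean L m (Y J) j false)
          rw [div_mul_eq_mul_div]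
          gcongr
          linarith
      _ ≤ 2 / pmin ^ 3 * (C * J) := by
          rw [← Finset.mul_sum]
          gcongr
          exact sum_max_pow_four_le Y hC J
      _ = _ := by ring
  · simp only [integral_observedTerm_sq D Y hp]
    exact eventually_le_sum_secondMoment D Y hpmin hC ν hν hconv hpos
  · simp only [integral_observedTerm_sq D Y hp, variance_observedTerm D Y hp]
    refine (hS.div hQ hτ0.ne').congr' ?_
    filter_upwards [eventually_gt_atTop 0] with J hJ0
    have hJ' : (J : ℝ) ≠ 0 := by positivity
    exact div_div_div_cancel_right₀ hJ' _ _

include hpmin hp hC hν hconv hpos in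
/-- With probability tending to one the observed session means have average square bounded below,
so that the resampling distribution is nondegenerate. -/
theorem exists_eventually_sum_sq_lt_le : ∃ c > 0, ∀ ε > 0, ∀ᶠ J : ℕ in atTop,
    (D J).labelLaw.real {z | ∑ j, focalMean L m (Y J) j (z j) ^ 2 < c * J} ≤ ε := by
  have h0 := hpmin.1
  -- Twice this `c` is an eventual lower bound for the expected average square.
  set c := pmin ^ 2 * sigmaSqS ν / 4 with hc
  have hc0 : 0 < c := by positivity
  refine ⟨c, hc0, fun ε hε => ?_⟩
  have hlim : Tendsto (fun J : ℕ => C / c ^ 2 / (J : ℝ)) atTop (𝓝 0) :=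
    tendsto_natCast_atTop_atTop.const_div_atTop _
  filter_upwards [eventually_le_sum_secondMoment D Y hpmin hC ν hν hconv hpos,
    hlim.eventually_lt_const hε, eventually_gt_atTop 0] with J hJ hJε hJ0
  have hJ' : (0 : ℝ) < J := by exact_mod_cast hJ0
  have hmean : 2 * (c * J)
      ≤ ∑ j, ∫ b, focalMean L m (Y J) j b ^ 2 ∂((D J).sessionLaw j) := by
    have h1 : ∀ j, pmin ^ 2 * secondMoment pmin (sessionTriple L m (D J) (Y J) j)
        ≤ ∫ b, focalMean L m (Y J) j b ^ 2 ∂((D J).sessionLaw j) := by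
      intro j
      have h2 := secondMoment_le hpmin (sessionTriple L m (D J) (Y J) j)
      have h3 := hp J j
      rw [integral_bernoulliMeasure]
      rw [le_div_iff₀ h0] at h2
      simp only [sessionTriple] at h2
      have h4 : pmin * focalMean L m (Y J) j true ^ 2
          ≤ (D J).q j * focalMean L m (Y J) j true ^ 2 := by gcongr; exact h3.1
      have h5 : pmin * focalMean L m (Y J) j false ^ 2
          ≤ (1 - (D J).q j) * focalMean L m (Y J) j false ^ 2 := by
        gcongr; linarith [h3.2]
      have h6 := mul_le_mul_of_nonneg_left h2 h0.le
      simp only [sessionTriple, smul_eq_mul]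
      linarith
    refine le_trans ?_ (Finset.sum_le_sum fun j _ => h1 j)
    rw [← Finset.mul_sum]
    have := mul_le_mul_of_nonneg_left hJ (sq_nonneg pmin)
    rw [hc]
    linarith
  have hch := measureReal_abs_sum_sub_ge_le (fun j => (D J).sessionLaw j)
    (fun j b => focalMean L m (Y J) j b ^ 2) (a := c * J) (by positivity)
  refine (measureReal_mono fun z hz => ?_).trans (hch.trans (le_trans ?_ hJε.le))
  · have hz' : ∑ j, focalMean L m (Y J) j (z j) ^ 2 < c * J := hz
    show c * J ≤ |_|
    rw [abs_sub_comm]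
    exact le_trans (by linarith) (le_abs_self _)
  · have h4 : ∑ j, ∫ b, (focalMean L m (Y J) j b ^ 2) ^ 2 ∂((D J).sessionLaw j) ≤ C * J := by
      refine le_trans (Finset.sum_le_sum fun j _ => ?_) (sum_max_pow_four_le Y hC J)
      obtain ⟨h1, h2⟩ := pow_four_le_max (focalMean L m (Y J) j true) (focalMean L m (Y J) j false)
      calc _ ≤ ∫ b, (max |focalMean L m (Y J) j true| |focalMean L m (Y J) j false|) ^ 4
            ∂((D J).sessionLaw j) := by
            refine integral_mono Integrable.of_finite Integrable.of_finite fun b => ?_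
            show (focalMean L m (Y J) j b ^ 2) ^ 2 ≤ _
            rw [← pow_mul]
            cases b
            · exact h2
            · exact h1
        _ = _ := by simp
    calc _ ≤ C * J / (c * J) ^ 2 := by gcongr
      _ = C / c ^ 2 / (J : ℝ) := by field_simp

variable (hD : ∀ J, (D J).EqualLength L) (hna : ∀ J, NonAnticipating (Y J))
  (hco : ∀ J, CarryoverAtMost m (Y J))

include hpmin hp hC hν hconv hpos hD hna hco in
/-- Asymptotic upper bound for the distribution function of the exact resampling `p`-value at one
level `v = 1 - Φ(s)`: unless the observed means are degenerate, a `p`-value of at most `v` forces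
the statistic above any fixed `s' < s`. -/
theorem eventually_resamplingPValue_le {r : ℝ≥0} (hr : r ≠ 0)
    (htail : ∀ s : ℝ, ∀ ε > 0, ∀ᶠ J in atTop,
      (D J).labelLaw.real {z | s ≤ selfNormalized (observedTerm L m (D J) (Y J)) z}
        ≤ (gaussianReal 0 r).real (Set.Ici s) + ε) {v : ℝ} (hv0 : 0 < v) (hv1 : v ≤ 1) {ε : ℝ}
    (hε : 0 < ε) :
    ∀ᶠ J in atTop, (D J).labelLaw.real {z | resamplingPValue L m (D J) (Y J) z ≤ v}
      ≤ limitPValueCDF r v + ε := by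
  rcases hv1.eq_or_lt with rfl | hv1
  · refine Eventually.of_forall fun J => measureReal_le_one.trans ?_
    rw [limitPValueCDF_one]
    linarith
  have := nullSingletonClass_gaussianReal (μ := 0) hr
  obtain ⟨s, hs⟩ := exists_gaussianCDF_eq (v := 1 - v) (by linarith) (by linarith)
  obtain ⟨η, hη, hηs⟩ := exists_measureReal_Ici_sub_le (gaussianReal 0 r) s
    (show 0 < ε / 3 by positivity)
  have hv : v = 1 - gaussianCDF s := by linarith
  have hgap : gaussianCDF (s - η) < gaussianCDF s := strictMono_gaussianCDF (by linarith)
  obtain ⟨c, hc, hbad⟩ := exists_eventually_sum_sq_lt_le D Y hpmin hp hC ν hν hconv hpos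
  filter_upwards [htail (s - η) (ε / 3) (by positivity), hbad (ε / 3) (by positivity),
    eventually_forall_resampled_tail_le D hpmin hp (C := C) hc (-(s - η))
      (ε := (gaussianCDF s - gaussianCDF (s - η)) / 2) (by linarith)] with J hJ1 hJ2 hJ3
  rw [gaussianReal_Ici_neg] at hJ3
  have hsub : {z | resamplingPValue L m (D J) (Y J) z ≤ v}
      ⊆ {z | s - η ≤ selfNormalized (observedTerm L m (D J) (Y J)) z}
        ∪ {z | ∑ j, focalMean L m (Y J) j (z j) ^ 2 < c * J} := by
    intro z hz
    by_contra hcon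
    simp only [Set.mem_union, Set.mem_ofPred_eq, not_or, not_le, not_lt] at hcon
    obtain ⟨hcon1, hcon2⟩ := hcon
    have hz' : resamplingPValue L m (D J) (Y J) z ≤ v := hz
    have hobs : ∀ j, observedMean L m (Y J) ((D J).path z) j = focalMean L m (Y J) j (z j) :=
      observedMean_path (D J) (hD J) (Y J) (hna J) (hco J) z
    set y := observedMean L m (Y J) ((D J).path z) with hy
    have h4 : ∑ j, (-y j) ^ 4 ≤ C * J := by
      refine le_trans (Finset.sum_le_sum fun j _ => ?_) (sum_max_pow_four_le Y hC J)
      obtain ⟨h1, h2⟩ := pow_four_le_max (focalMean L m (Y J) j true) (focalMean L m (Y J) j false)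
      rw [hobs, Even.neg_pow (by decide)]
      cases z j
      · exact h2
      · exact h1
    have h2 : c * J ≤ ∑ j, (-y j) ^ 2 := by
      simpa only [neg_sq, hobs] using hcon2
    -- The upper tail bound for `-y` is a lower tail bound for the statistic resampled from `y`.
    have h5 := hJ3 (fun j => -y j) h2 h4
    simp only [selfNormalized_htTerm_neg, ← tStud_eq_selfNormalized, neg_le_neg_iff] at h5
    have hobsT : tStud (D J).q y z < s - η := by
      rw [hy, tStud_observedMean (D J) (hD J) (Y J) (hna J) (hco J) z]
      exact hcon1
    have h6 : 1 ≤ (D J).labelLaw.real {z' | tStud (D J).q y z' ≤ s - η}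
        + resamplingPValue L m (D J) (Y J) z := by
      have huniv : (Set.univ : Set (Fin J → Bool)) ⊆ {z' | tStud (D J).q y z' ≤ s - η}
          ∪ {z' | tStud (D J).q y z ≤ tStud (D J).q y z'} := by
        intro z' _
        rcases le_total (tStud (D J).q y z') (s - η) with h | h
        · exact Or.inl h
        · exact Or.inr (hobsT.le.trans h)
      have h7 := (measureReal_mono huniv).trans
        (measureReal_union_le (μ := (D J).labelLaw) _ _)
      rw [probReal_univ] at h7
      exact h7
    linarith
  have h8 := (measureReal_mono hsub).trans (measureReal_union_le (μ := (D J).labelLaw) _ _)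
  rw [hv, limitPValueCDF_eq, ← hv]
  linarith

include hpmin hp hC hν hconv hpos hD hna hco in
theorem limsup_rejectionProb_le (hnull : ∀ J, focalAverageEffect L m (Y J) = 0) (M : ℕ → ℕ) {α : ℝ}
    (hα0 : 0 < α) (hα : α ≤ 1 / 2) :
    limsup (fun J => rejectionProb L m (D J) (Y J) (M J) α) atTop ≤ ENNReal.ofReal α := by
  obtain ⟨r, hr, hr1, htail⟩ := exists_observed_tail_le D Y hpmin hp hC ν hν hconv hpos hnull
  refine ENNReal.le_of_forall_pos_le_add fun ε hε _ => ?_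
  have hε' : (0 : ℝ) < ε := hε
  rw [← ENNReal.ofReal_coe_nnreal, ← ENNReal.ofReal_add hα0.le hε'.le]
  refine limsup_le_of_le (by isBoundedDefault) ?_
  have hunif := eventually_forall_le_of_monotone (l := atTop)
    (G := fun J v => (D J).labelLaw.real {z | resamplingPValue L m (D J) (Y J) z ≤ v})
    (fun J a b hab => measureReal_mono fun z (hz : _ ≤ a) => le_trans hz hab)
    (continuous_limitPValueCDF hr)
    (fun v hv0 hv1 δ hδ => eventually_resamplingPValue_le D Y hpmin hp hC ν hν hconv hpos hD hna
      hco hr htail hv0 hv1 hδ) hε'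
  filter_upwards [hunif] with J hJ
  rw [rejectionProb_eq L m (D J) (Y J) (M J) hα0.le]
  refine ENNReal.ofReal_le_ofReal ?_
  have hfloor : (⌊α * (M J + 1)⌋₊ : ℝ) ≤ α * (M J + 1) := Nat.floor_le (by positivity)
  have hM : (0 : ℝ) < M J + 1 := by positivity
  have hk : 2 * ⌊α * (M J + 1)⌋₊ ≤ M J + 1 := by
    have : (2 * ⌊α * (M J + 1)⌋₊ : ℝ) ≤ M J + 1 := by nlinarith
    exact_mod_cast this
  refine (integral_binomialTail_le (D J).labelLaw (resamplingPValue L m (D J) (Y J))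
    (fun z => measureReal_nonneg) (fun z => measureReal_le_one) (continuous_limitPValueCDF hr)
    (fun v => limitPValueCDF_le hr hr1) (fun v _ _ => limitPValueCDF_add_le hr v) hε'.le hJ
    hk).trans ?_
  gcongr
  exact (div_le_iff₀ hM).2 hfloor

end MainAsymptotics

end Switchback

theorem theorem3 (m L : ℕ) (hmL : m < L)
    (D : ∀ J : ℕ, Switchback.RegularSwitchback (J * L) J)
    (hD : ∀ J, (D J).EqualLength L)
    (Y : ∀ J : ℕ, Switchback.PotentialOutcomes (J * L))
    (hna : ∀ J, Switchback.NonAnticipating (Y J))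
    (hco : ∀ J, Switchback.CarryoverAtMost m (Y J))
    -- assignment probabilities bounded away from zero and one
    (pmin : ℝ) (hpmin : pmin ∈ Set.Ioo (0 : ℝ) (1 / 2))
    (hp : ∀ J j, (D J).q j ∈ Set.Icc pmin (1 - pmin))
    -- uniform fourth-moment bound
    (C : ℝ)
    (hC : ∀ J : ℕ, 1 ≤ J →
      (∑ j, (max |Switchback.focalMean L m (Y J) j true|
        |Switchback.focalMean L m (Y J) j false|) ^ 4) / (J : ℝ) ≤ C)
    -- stabilization
    (ν : ProbabilityMeasure (ℝ × ℝ × ℝ))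
    (hν : ν (Set.Icc pmin (1 - pmin) ×ˢ Set.univ) = 1)
    (hconv : Tendsto (fun J => Switchback.empiricalLaw L m (D J) (Y J)) atTop
      (𝓝 ν.toFiniteMeasure))
    -- nondegeneracy
    (hpos : 0 < Switchback.sigmaSqS ν)
    -- number of Monte Carlo resamples, possibly depending on the number of sessions
    (M : ℕ → ℕ) :
    ((∀ J, Switchback.focalAverageEffect L m (Y J) = 0) →
      ∀ α : ℝ, 0 < α → α ≤ 1 / 2 →
        limsup (fun J => Switchback.rejectionProb L m (D J) (Y J) (M J) α) atTop
          ≤ ENNReal.ofReal α) ∧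
    ((∀ J l, Switchback.positionEffect L m (Y J) l = 0) →
      ∀ α : ℝ, 0 < α → α ≤ 1 / 2 →
        limsup (fun J => Switchback.rejectionProb L m (D J) (Y J) (M J) α) atTop
          ≤ ENNReal.ofReal α) := by
  have hmain : (∀ J, Switchback.focalAverageEffect L m (Y J) = 0) →
      ∀ α : ℝ, 0 < α → α ≤ 1 / 2 →
        limsup (fun J => Switchback.rejectionProb L m (D J) (Y J) (M J) α) atTop
          ≤ ENNReal.ofReal α := fun hnull α hα0 hα =>
    Switchback.limsup_rejectionProb_le D Y hpmin hp hC ν hν hconv hpos hD hna hco hnull M hα0 hα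
  exact ⟨hmain, fun h => hmain fun J => Switchback.focalAverageEffect_eq_zero (Y J) (h J)⟩
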